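/- Let $k$ be an algebraically closed field of characteristic zero and let $n\ge 0$ be an integer. A group-valued prestack is a functor $H$ from commutative $k$-algebras to groups. A representation of $H$ is a $k$-vector space $V$ together with group homomorphisms $H(R)\to GL_R(R\otimes_k V)$, natural in the $k$-algebra $R$; a morphism of representations is a $k$-linear map $V\to W$ which, after base change to every $R$, commutes with the action of $H(R)$. Write $\mathrm{Rep}(H)$ for the resulting category. A subrepresentation is a subspace $W\subseteq V$ such that $R\otimes_k W$ is stable under $H(R)$ for all $R$, and $V$ is locally finite if every vector of $V$ lies in a finite-dimensional subrepresentation. Let $K$ be the group-valued prestack for which $K(R)$ is the group of continuous automorphisms $\rho$ of the $R$-algebra $R[[t_1,\dots,t_n]]$ such that every $\rho(t_i)$ has zero constant term. For $S=\operatorname{Spec}R$, a strict common étale neighbourhood of $(S\times\mathbb A^n, 0)$ with itself is an $S$-scheme $V$ with a section $\tau:S\to V$ and two étale $S$-morphisms $\phi,\psi:V\to S\times\mathbb A^n$, both carrying $\tau$ to the zero section; completing along the sections, it induces an automorphism $\hat\phi\circ\hat\psi^{-1}$ of $S\times\widehat{\mathbb A}^n$ preserving the zero section, that is, an element of $K(R)$.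 Let $K^{\text{ét}}(R)\subseteq K(R)$ be the subgroup of all elements arising in this way; this defines a group-valued subprestack $K^{\text{ét}}\subseteq K$. Then the restriction functor $\mathrm{Rep}(K)\to\mathrm{Rep}(K^{\text{ét}})$ is fully faithful, and its essential image is the full subcategory of locally finite representations of $K^{\text{ét}}$. -/

import Mathlib

open CategoryTheory AlgebraicGeometry Limits
open scoped TensorProduct

universe u

noncomputable section

namespace FormalDisc

/-- The ideal `𝔪 = (t₁, …, tₙ)` of `R⟦t₁, …, tₙ⟧`. -/
def originIdeal (n : ℕ) (R : Type u) [CommRing R] : Ideal (MvPowerSeries (Fin n) R) :=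
  Ideal.span (Set.range MvPowerSeries.X)

section PowerSeries

variable {n : ℕ} {R : Type u} [CommRing R]

lemma mem_originIdeal_iff {f : MvPowerSeries (Fin n) R} :
    f ∈ originIdeal n R ↔ MvPowerSeries.constantCoeff f = 0 := by
  classical
  constructor
  · intro hf
    have : originIdeal n R ≤ RingHom.ker (MvPowerSeries.constantCoeff (σ := Fin n) (R := R)) := by
      rw [originIdeal, Ideal.span_le]
      rintro _ ⟨k, rfl⟩
      simp
    exact this hf
  · intro hf
    have key : ∀ d : Fin n →₀ ℕ, d ≠ 0 → ∃ k, d k ≠ 0 := fun d hd => by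
      by_contra! h
      exact hd (Finsupp.ext h)
    choose i hi using key
    let g : Fin n → MvPowerSeries (Fin n) R := fun k d =>
      if ∃ h : d ≠ 0, i d h = k then MvPowerSeries.coeff d f else 0
    have hg : ∀ k d, MvPowerSeries.coeff d (g k) =
        if ∃ h : d ≠ 0, i d h = k then MvPowerSeries.coeff d f else 0 := fun k d => rfl
    have hsum : f = ∑ k, g k := by
      ext d
      rw [map_sum]
      simp only [hg]
      by_cases hd : d = 0
      · subst hd
        simpa using hf
      · simp [hd]
    rw [hsum]
    refine Ideal.sum_mem _ fun k _ => ?_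
    have hdvd : MvPowerSeries.X k ∣ g k := by
      rw [MvPowerSeries.X_dvd_iff]
      intro d hd
      rw [hg, if_neg]
      rintro ⟨h0, rfl⟩
      exact hi d h0 hd
    exact Ideal.mem_of_dvd _ hdvd (Ideal.subset_span ⟨k, rfl⟩)

lemma le_order_of_mem_pow (c : ℕ) {f : MvPowerSeries (Fin n) R}
    (hf : f ∈ originIdeal n R ^ c) : (c : ℕ∞) ≤ f.order := by
  induction c generalizing f with
  | zero => simp
  | succ c ih =>
    rw [pow_succ] at hf
    refine Submodule.mul_induction_on hf (fun a ha b hb => ?_) (fun a b ha hb => ?_)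
    · have h1 : (1 : ℕ∞) ≤ b.order :=
        MvPowerSeries.one_le_order_iff_constCoeff_eq_zero.2 (mem_originIdeal_iff.1 hb)
      push_cast
      exact (add_le_add (ih ha) h1).trans MvPowerSeries.le_order_mul
    · exact (le_min ha hb).trans MvPowerSeries.min_order_le_add

/-- `R`-algebra maps out of `R⟦t₁, …, tₙ⟧` sending the variables into `𝔪` are determined by their
values on the variables. -/
lemma algHom_ext_of_X {F G : MvPowerSeries (Fin n) R →ₐ[R] MvPowerSeries (Fin n) R}
    (hF : ∀ k, MvPowerSeries.constantCoeff (F (MvPowerSeries.X k)) = 0)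
    (h : ∀ k, F (MvPowerSeries.X k) = G (MvPowerSeries.X k)) : F = G := by
  have key : ∀ (c : ℕ) (f : MvPowerSeries (Fin n) R), F f - G f ∈ originIdeal n R ^ c := by
    intro c
    induction c with
    | zero => intro f; simp
    | succ c ih =>
      intro f
      have hf : f - MvPowerSeries.C (MvPowerSeries.constantCoeff f) ∈ originIdeal n R := by
        rw [mem_originIdeal_iff]; simp
      obtain ⟨a, ha⟩ := (Ideal.mem_span_range_iff_exists_fun).1 hf
      have hC : ∀ r : R, F (MvPowerSeries.C r) = G (MvPowerSeries.C r) := fun r =>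
        (F.commutes r).trans (G.commutes r).symm
      have hf' : F f - G f = ∑ k, (F (a k) - G (a k)) * F (MvPowerSeries.X k) := by
        have e : f = (∑ k, a k * MvPowerSeries.X k) +
            MvPowerSeries.C (MvPowerSeries.constantCoeff f) := by rw [ha]; ring
        conv_lhs => rw [e]
        simp only [map_add, map_sum, map_mul, hC, ← h, sub_mul, Finset.sum_sub_distrib]
        ring
      rw [hf', pow_succ]
      exact Ideal.sum_mem _ fun k _ => Ideal.mul_mem_mul (ih _) (mem_originIdeal_iff.2 (hF k))
  refine AlgHom.ext fun f => sub_eq_zero.1 (MvPowerSeries.order_eq_top_iff.1 ?_)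
  exact ENat.eq_top_iff_forall_ge.2 fun c => le_order_of_mem_pow c (key c f)

lemma constantCoeff_algHom {F : MvPowerSeries (Fin n) R →ₐ[R] MvPowerSeries (Fin n) R}
    (hF : ∀ k, MvPowerSeries.constantCoeff (F (MvPowerSeries.X k)) = 0)
    (f : MvPowerSeries (Fin n) R) :
    MvPowerSeries.constantCoeff (F f) = MvPowerSeries.constantCoeff f := by
  have hf : f - MvPowerSeries.C (MvPowerSeries.constantCoeff f) ∈ originIdeal n R := by
    rw [mem_originIdeal_iff]; simp
  have hle : originIdeal n R ≤ (originIdeal n R).comap F := by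
    conv_lhs => rw [originIdeal]
    rw [Ideal.span_le]
    rintro _ ⟨k, rfl⟩
    exact mem_originIdeal_iff.2 (hF k)
  have h2 := mem_originIdeal_iff.1 (hle hf)
  have hC : ∀ r : R, F (MvPowerSeries.C r) = MvPowerSeries.C r := fun r => F.commutes r
  rw [map_sub, hC, map_sub, sub_eq_zero] at h2
  simpa using h2

lemma originIdeal_pow_le_comap {R' : Type u} [CommRing R']
    (F : MvPowerSeries (Fin n) R →+* MvPowerSeries (Fin n) R')
    (hF : ∀ k, MvPowerSeries.constantCoeff (F (MvPowerSeries.X k)) = 0) (c : ℕ) :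
    originIdeal n R ^ c ≤ (originIdeal n R' ^ c).comap F := by
  rw [← Ideal.map_le_iff_le_comap, Ideal.map_pow]
  refine Ideal.pow_right_mono ?_ c
  rw [originIdeal, Ideal.map_span, Ideal.span_le]
  rintro _ ⟨_, ⟨k, rfl⟩, rfl⟩
  exact mem_originIdeal_iff.2 (hF k)

end PowerSeries

/-- `K(R)`: the group (under composition) of automorphisms `ρ` of the `R`-algebra `R⟦t₁, …, tₙ⟧`
such that every `ρ(t_k)` has zero constant term. Such a `ρ` maps `𝔪 ^ c` into `𝔪 ^ c` for all `c`
(`originIdeal_pow_le_comap`), so it is automatically continuous for the `𝔪`-adic topology. -/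
def discAut (n : ℕ) (R : Type u) [CommRing R] :
    Subgroup (MvPowerSeries (Fin n) R ≃ₐ[R] MvPowerSeries (Fin n) R) where
  carrier := {ρ | ∀ k, MvPowerSeries.constantCoeff (ρ (MvPowerSeries.X k)) = 0}
  one_mem' := by intro k; simp
  mul_mem' := by
    intro a b ha hb k
    exact (constantCoeff_algHom (F := a.toAlgHom) ha _).trans (hb k)
  inv_mem' := by
    intro a ha k
    have := constantCoeff_algHom (F := a.toAlgHom) ha (a⁻¹ (MvPowerSeries.X k))
    have e : a.toAlgHom (a⁻¹ (MvPowerSeries.X k)) = MvPowerSeries.X k :=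
      AlgEquiv.apply_symm_apply a _
    rw [e] at this
    rw [← this]; simp

section BaseChange

variable {n : ℕ} {R R' R'' : Type u} [CommRing R] [CommRing R'] [CommRing R'']

lemma discAut_hasSubst (f : R →+* R') (ρ : discAut n R) :
    MvPowerSeries.HasSubst
      (fun k => MvPowerSeries.map f (ρ.1 (MvPowerSeries.X k)) :
        Fin n → MvPowerSeries (Fin n) R') :=
  MvPowerSeries.hasSubst_of_constantCoeff_zero fun k => by
    have h : MvPowerSeries.constantCoeff (ρ.1 (MvPowerSeries.X k)) = 0 := ρ.2 k
    simp [h]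

lemma discAut_apply_eq_subst (ρ : discAut n R) (g : MvPowerSeries (Fin n) R) :
    ρ.1 g = MvPowerSeries.subst (fun k => ρ.1 (MvPowerSeries.X k)) g := by
  have hs : MvPowerSeries.HasSubst (fun k => ρ.1 (MvPowerSeries.X k)) :=
    MvPowerSeries.hasSubst_of_constantCoeff_zero ρ.2
  rw [← MvPowerSeries.substAlgHom_apply hs]
  refine DFunLike.congr_fun (algHom_ext_of_X (F := ρ.1.toAlgHom) ρ.2 fun k => ?_) g
  rw [MvPowerSeries.substAlgHom_X]
  rfl

/-- The `R'`-algebra endomorphism of `R'⟦t⟧` with `t_k ↦ f(ρ(t_k))`. -/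
def discAutMapHom (f : R →+* R') (ρ : discAut n R) :
    MvPowerSeries (Fin n) R' →ₐ[R'] MvPowerSeries (Fin n) R' :=
  MvPowerSeries.substAlgHom (discAut_hasSubst f ρ)

lemma discAutMapHom_X (f : R →+* R') (ρ : discAut n R) (k : Fin n) :
    discAutMapHom f ρ (MvPowerSeries.X k) = MvPowerSeries.map f (ρ.1 (MvPowerSeries.X k)) :=
  MvPowerSeries.substAlgHom_X _ k

lemma discAutMapHom_map (f : R →+* R') (ρ : discAut n R) (g : MvPowerSeries (Fin n) R) :
    discAutMapHom f ρ (MvPowerSeries.map f g) = MvPowerSeries.map f (ρ.1 g) := by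
  rw [discAut_apply_eq_subst ρ g, MvPowerSeries.map_subst
    (MvPowerSeries.hasSubst_of_constantCoeff_zero ρ.2), discAutMapHom,
    MvPowerSeries.substAlgHom_apply]

lemma discAutMapHom_constantCoeff (f : R →+* R') (ρ : discAut n R) (k : Fin n) :
    MvPowerSeries.constantCoeff (discAutMapHom f ρ (MvPowerSeries.X k)) = 0 := by
  have h : MvPowerSeries.constantCoeff (ρ.1 (MvPowerSeries.X k)) = 0 := ρ.2 k
  rw [discAutMapHom_X]; simp [h]

lemma discAutMapHom_mul (f : R →+* R') (ρ σ : discAut n R) :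
    discAutMapHom f (ρ * σ) = (discAutMapHom f ρ).comp (discAutMapHom f σ) := by
  refine algHom_ext_of_X (discAutMapHom_constantCoeff f _) fun k => ?_
  rw [discAutMapHom_X, AlgHom.comp_apply, discAutMapHom_X, discAutMapHom_map]
  rfl

lemma discAutMapHom_one (f : R →+* R') :
    discAutMapHom f (1 : discAut n R) = AlgHom.id R' _ := by
  refine algHom_ext_of_X (discAutMapHom_constantCoeff f _) fun k => ?_
  rw [discAutMapHom_X]
  simp

/-- The homomorphism `K(R) → K(R')` induced by `f : R → R'`: apply `f` to all coefficients of the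
series `ρ(t_k)`. -/
def discAutMap (f : R →+* R') : discAut n R →* discAut n R' where
  toFun ρ := ⟨AlgEquiv.ofAlgHom (discAutMapHom f ρ) (discAutMapHom f ρ⁻¹)
      (by rw [← discAutMapHom_mul, mul_inv_cancel, discAutMapHom_one])
      (by rw [← discAutMapHom_mul, inv_mul_cancel, discAutMapHom_one]),
    discAutMapHom_constantCoeff f ρ⟩
  map_one' := by
    refine Subtype.ext (AlgEquiv.ext fun g => ?_)
    exact DFunLike.congr_fun (discAutMapHom_one f) g
  map_mul' ρ σ := by
    refine Subtype.ext (AlgEquiv.ext fun g => ?_)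
    exact DFunLike.congr_fun (discAutMapHom_mul f ρ σ) g

lemma discAutMap_X (f : R →+* R') (ρ : discAut n R) (k : Fin n) :
    (discAutMap f ρ).1 (MvPowerSeries.X k) = MvPowerSeries.map f (ρ.1 (MvPowerSeries.X k)) :=
  discAutMapHom_X f ρ k

lemma discAut_ext {ρ σ : discAut n R}
    (h : ∀ k, ρ.1 (MvPowerSeries.X k) = σ.1 (MvPowerSeries.X k)) : ρ = σ := by
  refine Subtype.ext (AlgEquiv.ext fun g => ?_)
  exact DFunLike.congr_fun
    (algHom_ext_of_X (F := ρ.1.toAlgHom) (G := σ.1.toAlgHom) ρ.2 h) g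

lemma discAutMap_id (ρ : discAut n R) : discAutMap (RingHom.id R) ρ = ρ :=
  discAut_ext fun k => by rw [discAutMap_X, MvPowerSeries.map_id]; rfl

lemma discAutMap_comp (f : R →+* R') (g : R' →+* R'') (ρ : discAut n R) :
    discAutMap (g.comp f) ρ = discAutMap g (discAutMap f ρ) :=
  discAut_ext fun k => by
    rw [discAutMap_X, discAutMap_X, discAutMap_X, MvPowerSeries.map_comp]; rfl

end BaseChange


/-! ### Common étale neighbourhoods -/

section Scheme

/-- The morphism of affine schemes `Spec B ⟶ Spec A` given by a ring homomorphism `A → B`. -/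
abbrev specMap {A B : Type u} [CommRing A] [CommRing B] (f : A →+* B) :
    Spec (CommRingCat.of B) ⟶ Spec (CommRingCat.of A) :=
  Spec.map (CommRingCat.ofHom f)

lemma specMap_comp {A B C : Type u} [CommRing A] [CommRing B] [CommRing C]
    (f : A →+* B) (g : B →+* C) : specMap g ≫ specMap f = specMap (g.comp f) := by
  rw [specMap, specMap, ← Spec.map_comp, ← CommRingCat.ofHom_comp]

variable (n : ℕ) (R : Type u) [CommRing R]

/-- Affine `n`-space `S × 𝔸ⁿ` over `S = Spec R`. -/
abbrev affineSpace : Scheme.{u} := Spec (CommRingCat.of (MvPolynomial (Fin n) R))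

/-- The projection `S × 𝔸ⁿ ⟶ S`. -/
abbrev affineProj : affineSpace n R ⟶ Spec (CommRingCat.of R) :=
  specMap (MvPolynomial.C : R →+* MvPolynomial (Fin n) R)

/-- The zero section `S ⟶ S × 𝔸ⁿ`. -/
abbrev zeroSection : Spec (CommRingCat.of R) ⟶ affineSpace n R :=
  specMap (MvPolynomial.constantCoeff : MvPolynomial (Fin n) R →+* R)

/-- The ring `R⟦t⟧ ⧸ 𝔪 ^ (c + 1)` of functions on the `c`-th infinitesimal neighbourhood of the
zero section in `S × 𝔸ⁿ`. -/
abbrev JetRing (c : ℕ) : Type u := MvPowerSeries (Fin n) R ⧸ originIdeal n R ^ (c + 1)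

/-- The quotient map `R⟦t⟧ → R⟦t⟧ ⧸ 𝔪 ^ (c + 1)`. -/
abbrev toJet (c : ℕ) : MvPowerSeries (Fin n) R →+* JetRing n R c :=
  Ideal.Quotient.mk (originIdeal n R ^ (c + 1))

/-- Evaluation at the origin, `R⟦t⟧ ⧸ 𝔪 ^ (c + 1) → R`. -/
def jetEval (c : ℕ) : JetRing n R c →+* R :=
  Ideal.Quotient.lift _ MvPowerSeries.constantCoeff fun _ hf =>
    mem_originIdeal_iff.1 (Ideal.pow_le_self c.succ_ne_zero hf)

/-- The inclusion `R[t] → R⟦t⟧`. -/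
abbrev polyToSeries : MvPolynomial (Fin n) R →+* MvPowerSeries (Fin n) R :=
  MvPolynomial.coeToMvPowerSeries.ringHom

/-- A strict common étale neighbourhood of the trivial pointed `n`-dimensional family
`S × 𝔸ⁿ ⇄ S` (with its zero section) with itself, over `S = Spec R`: an `S`-scheme `V` with a
section `τ` and two étale morphisms `φ, ψ : V ⟶ S × 𝔸ⁿ` compatible with the projections to `S` and
with the sections. (As `φ` is étale, `π : V ⟶ S` is automatically smooth of relative
dimension `n`.) -/
structure StrictEtaleNbhd where
  V : Scheme.{u}
  π : V ⟶ Spec (CommRingCat.of R)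
  τ : Spec (CommRingCat.of R) ⟶ V
  φ : V ⟶ affineSpace n R
  ψ : V ⟶ affineSpace n R
  etale_φ : Etale φ
  etale_ψ : Etale ψ
  τ_π : τ ≫ π = 𝟙 _
  φ_proj : φ ≫ affineProj n R = π
  ψ_proj : ψ ≫ affineProj n R = π
  τ_φ : τ ≫ φ = zeroSection n R
  τ_ψ : τ ≫ ψ = zeroSection n R

variable {n R}

/-- `ρ ∈ K(R)` is the automorphism induced by the common étale neighbourhood `(V, φ, ψ)`, i.e. the
automorphism of `S × Spf R⟦t⟧` given by `ρ` is `φ̂ ∘ ψ̂⁻¹`, where `φ̂` and `ψ̂` are the isomorphisms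
induced by `φ` and `ψ` from the formal completion of `V` along `τ` to that of `S × 𝔸ⁿ` along the
zero section. On `c`-th infinitesimal neighbourhoods: since `ψ` is étale there is a unique
`S`-morphism `ℓ` (namely `(ψ^(c))⁻¹`) from the `c`-th infinitesimal neighbourhood of the zero
section to `V` which extends `τ` and satisfies that `ℓ ≫ ψ` is the canonical inclusion into
`S × 𝔸ⁿ`; then `ℓ ≫ φ` has to be given by the truncations of the series `ρ(t_k)`. -/
def StrictEtaleNbhd.Induces (E : StrictEtaleNbhd n R) (ρ : discAut n R) : Prop :=
  ∀ c : ℕ, ∃ ℓ : Spec (CommRingCat.of (JetRing n R c)) ⟶ E.V,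
    specMap (jetEval n R c) ≫ ℓ = E.τ ∧
    ℓ ≫ E.ψ = specMap ((toJet n R c).comp (polyToSeries n R)) ∧
    ℓ ≫ E.φ = specMap ((toJet n R c).comp
      ((ρ.1 : MvPowerSeries (Fin n) R →+* MvPowerSeries (Fin n) R).comp (polyToSeries n R)))

/-- The map induced by `ρ ∈ K(R)` on `R⟦t⟧ ⧸ 𝔪 ^ (c + 1)`. -/
def jetMap (ρ : discAut n R) (c : ℕ) : JetRing n R c →+* JetRing n R c :=
  Ideal.quotientMap _ (ρ.1 : MvPowerSeries (Fin n) R →+* MvPowerSeries (Fin n) R)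
    (originIdeal_pow_le_comap
      (ρ.1 : MvPowerSeries (Fin n) R →+* MvPowerSeries (Fin n) R) ρ.2 _)

lemma jetMap_comp_toJet (ρ : discAut n R) (c : ℕ) :
    (jetMap ρ c).comp (toJet n R c) =
      (toJet n R c).comp (ρ.1 : MvPowerSeries (Fin n) R →+* MvPowerSeries (Fin n) R) :=
  Ideal.quotientMap_comp_mk _

lemma jetEval_comp_jetMap (ρ : discAut n R) (c : ℕ) :
    (jetEval n R c).comp (jetMap ρ c) = jetEval n R c := by
  refine Ideal.Quotient.ringHom_ext ?_
  rw [RingHom.comp_assoc, jetMap_comp_toJet]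
  refine RingHom.ext fun g => ?_
  exact constantCoeff_algHom (F := ρ.1.toAlgHom) ρ.2 g

/-- The identity neighbourhood `(S × 𝔸ⁿ, id, id)`. -/
abbrev StrictEtaleNbhd.refl (n : ℕ) (R : Type u) [CommRing R] : StrictEtaleNbhd n R where
  V := affineSpace n R
  π := affineProj n R
  τ := zeroSection n R
  φ := 𝟙 _
  ψ := 𝟙 _
  etale_φ := inferInstance
  etale_ψ := inferInstance
  τ_π := by
    rw [specMap_comp]
    have : (MvPolynomial.constantCoeff (σ := Fin n)).comp MvPolynomial.C = RingHom.id R :=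
      RingHom.ext fun r => MvPolynomial.constantCoeff_C _ r
    rw [this]
    exact Spec.map_id _
  φ_proj := Category.id_comp _
  ψ_proj := Category.id_comp _
  τ_φ := Category.comp_id _
  τ_ψ := Category.comp_id _

/-- The mirror image `(V, ψ, φ)`. -/
abbrev StrictEtaleNbhd.symm (E : StrictEtaleNbhd n R) : StrictEtaleNbhd n R where
  V := E.V
  π := E.π
  τ := E.τ
  φ := E.ψ
  ψ := E.φ
  etale_φ := E.etale_ψ
  etale_ψ := E.etale_φ
  τ_π := E.τ_π
  φ_proj := E.ψ_proj
  ψ_proj := E.φ_proj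
  τ_φ := E.τ_ψ
  τ_ψ := E.τ_φ

/-- The composite `V₁ ×_{S × 𝔸ⁿ} V₂` of two neighbourhoods. -/
abbrev StrictEtaleNbhd.comp (E₁ E₂ : StrictEtaleNbhd n R) : StrictEtaleNbhd n R :=
  haveI := E₁.etale_φ
  haveI := E₁.etale_ψ
  haveI := E₂.etale_φ
  haveI := E₂.etale_ψ
  { V := pullback E₁.φ E₂.ψ
    π := pullback.fst E₁.φ E₂.ψ ≫ E₁.π
    τ := pullback.lift E₁.τ E₂.τ (by rw [E₁.τ_φ, E₂.τ_ψ])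
    φ := pullback.snd E₁.φ E₂.ψ ≫ E₂.φ
    ψ := pullback.fst E₁.φ E₂.ψ ≫ E₁.ψ
    etale_φ := inferInstance
    etale_ψ := inferInstance
    τ_π := by rw [pullback.lift_fst_assoc, E₁.τ_π]
    φ_proj := by
      rw [Category.assoc, E₂.φ_proj, ← E₂.ψ_proj, ← pullback.condition_assoc, E₁.φ_proj]
    ψ_proj := by rw [Category.assoc, E₁.ψ_proj]
    τ_φ := by rw [pullback.lift_snd_assoc, E₂.τ_φ]
    τ_ψ := by rw [pullback.lift_fst_assoc, E₁.τ_ψ] }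

lemma StrictEtaleNbhd.induces_refl : (StrictEtaleNbhd.refl n R).Induces 1 := fun c => by
  refine ⟨specMap ((toJet n R c).comp (polyToSeries n R)), ?_, Category.comp_id _,
    Category.comp_id _⟩
  rw [specMap_comp]
  change _ = specMap _
  refine congrArg specMap ?_
  refine RingHom.ext fun p => ?_
  change MvPowerSeries.constantCoeff (p : MvPowerSeries (Fin n) R) = _
  simp [MvPolynomial.constantCoeff_eq, ← MvPowerSeries.coeff_zero_eq_constantCoeff_apply]

lemma StrictEtaleNbhd.Induces.symm {E : StrictEtaleNbhd n R} {ρ : discAut n R}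
    (h : E.Induces ρ) : E.symm.Induces ρ⁻¹ := fun c => by
  obtain ⟨ℓ, h1, h2, h3⟩ := h c
  refine ⟨specMap (jetMap ρ⁻¹ c) ≫ ℓ, ?_, ?_, ?_⟩
  · rw [← Category.assoc, specMap_comp, jetEval_comp_jetMap, h1]
  · change (_ ≫ ℓ) ≫ E.φ = _
    rw [Category.assoc, h3, specMap_comp, ← RingHom.comp_assoc, jetMap_comp_toJet,
      RingHom.comp_assoc, ← RingHom.comp_assoc (polyToSeries n R)]
    have : ((ρ⁻¹ : discAut n R).1 : MvPowerSeries (Fin n) R →+* MvPowerSeries (Fin n) R).comp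
        (ρ.1 : MvPowerSeries (Fin n) R →+* MvPowerSeries (Fin n) R) = RingHom.id _ :=
      RingHom.ext fun g => AlgEquiv.symm_apply_apply ρ.1 g
    rw [this, RingHom.id_comp]
  · change (_ ≫ ℓ) ≫ E.ψ = _
    rw [Category.assoc, h2, specMap_comp, ← RingHom.comp_assoc, jetMap_comp_toJet,
      RingHom.comp_assoc]

lemma StrictEtaleNbhd.Induces.comp {E₁ E₂ : StrictEtaleNbhd n R} {ρ₁ ρ₂ : discAut n R}
    (h₁ : E₁.Induces ρ₁) (h₂ : E₂.Induces ρ₂) : (E₁.comp E₂).Induces (ρ₁ * ρ₂) := fun c => by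
  obtain ⟨ℓ, h1, h2, h3⟩ := h₁ c
  obtain ⟨m, m1, m2, m3⟩ := h₂ c
  have w : ℓ ≫ E₁.φ = (specMap (jetMap ρ₁ c) ≫ m) ≫ E₂.ψ := by
    rw [Category.assoc, m2, specMap_comp, ← RingHom.comp_assoc, jetMap_comp_toJet,
      RingHom.comp_assoc, h3]
  refine ⟨pullback.lift ℓ (specMap (jetMap ρ₁ c) ≫ m) w, ?_, ?_, ?_⟩
  · refine pullback.hom_ext ?_ ?_
    · rw [Category.assoc, pullback.lift_fst, h1]
      exact (pullback.lift_fst _ _ _).symm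
    · rw [Category.assoc, pullback.lift_snd, ← Category.assoc, specMap_comp,
        jetEval_comp_jetMap, m1]
      exact (pullback.lift_snd _ _ _).symm
  · change _ ≫ pullback.fst E₁.φ E₂.ψ ≫ E₁.ψ = _
    rw [pullback.lift_fst_assoc, h2]
  · change _ ≫ pullback.snd E₁.φ E₂.ψ ≫ E₂.φ = _
    rw [pullback.lift_snd_assoc, Category.assoc, m3, specMap_comp, ← RingHom.comp_assoc,
      jetMap_comp_toJet, RingHom.comp_assoc]
    rfl

variable (n R) in
/-- `K^ét(R) ⊆ K(R)`: the automorphisms induced by strict common étale neighbourhoods of the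
trivial pointed family with itself. -/
def etaleAut : Subgroup (discAut n R) where
  carrier := {ρ | ∃ E : StrictEtaleNbhd n R, E.Induces ρ}
  one_mem' := ⟨_, StrictEtaleNbhd.induces_refl⟩
  mul_mem' := fun ⟨_, h₁⟩ ⟨_, h₂⟩ => ⟨_, h₁.comp h₂⟩
  inv_mem' := fun ⟨_, h⟩ => ⟨_, h.symm⟩

end Scheme

section BaseChangeNbhd

variable {n : ℕ} {R R' : Type u} [CommRing R] [CommRing R']

lemma affineSpace_isPullback (f : R →+* R') :
    IsPullback (specMap (MvPolynomial.map f : MvPolynomial (Fin n) R →+* _)) (affineProj n R')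
      (affineProj n R) (specMap f) := by
  let _ : Algebra R R' := f.toAlgebra
  let _ : Algebra (MvPolynomial (Fin n) R) (MvPolynomial (Fin n) R') :=
    MvPolynomial.algebraMvPolynomial
  have h := CommRingCat.isPushout_of_isPushout R (MvPolynomial (Fin n) R) R'
    (MvPolynomial (Fin n) R')
  exact h.flip.op.map Scheme.Spec

/-- The base change of a neighbourhood along `f : R → R'`. -/
abbrev StrictEtaleNbhd.baseChange (E : StrictEtaleNbhd n R) (f : R →+* R') :
    StrictEtaleNbhd n R' where
  V := pullback E.π (specMap f)
  π := pullback.snd _ _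
  τ := pullback.lift (specMap f ≫ E.τ) (𝟙 _) (by rw [Category.assoc, E.τ_π]; simp)
  φ := (affineSpace_isPullback f).lift (pullback.fst _ _ ≫ E.φ) (pullback.snd _ _)
    (by rw [Category.assoc, E.φ_proj, pullback.condition])
  ψ := (affineSpace_isPullback f).lift (pullback.fst _ _ ≫ E.ψ) (pullback.snd _ _)
    (by rw [Category.assoc, E.ψ_proj, pullback.condition])
  etale_φ := by
    have hp := IsPullback.of_right (t := (affineSpace_isPullback (n := n) f).flip)
      (h₁₁ := (affineSpace_isPullback f).lift (pullback.fst E.π (specMap f) ≫ E.φ)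
        (pullback.snd _ _) (by rw [Category.assoc, E.φ_proj, pullback.condition]))
      (h₂₁ := E.φ) (v₁₁ := pullback.fst E.π (specMap f))
      (by
        rw [IsPullback.lift_snd, E.φ_proj]
        exact (IsPullback.of_hasPullback E.π (specMap f)).flip)
      (by rw [IsPullback.lift_fst])
    exact MorphismProperty.of_isPullback hp.flip E.etale_φ
  etale_ψ := by
    have hp := IsPullback.of_right (t := (affineSpace_isPullback (n := n) f).flip)
      (h₁₁ := (affineSpace_isPullback f).lift (pullback.fst E.π (specMap f) ≫ E.ψ)
        (pullback.snd _ _) (by rw [Category.assoc, E.ψ_proj, pullback.condition]))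
      (h₂₁ := E.ψ) (v₁₁ := pullback.fst E.π (specMap f))
      (by
        rw [IsPullback.lift_snd, E.ψ_proj]
        exact (IsPullback.of_hasPullback E.π (specMap f)).flip)
      (by rw [IsPullback.lift_fst])
    exact MorphismProperty.of_isPullback hp.flip E.etale_ψ
  τ_π := pullback.lift_snd _ _ _
  φ_proj := IsPullback.lift_snd _ _ _ _
  ψ_proj := IsPullback.lift_snd _ _ _ _
  τ_φ := by
    refine (affineSpace_isPullback f).hom_ext ?_ ?_
    · rw [Category.assoc, IsPullback.lift_fst, pullback.lift_fst_assoc, Category.assoc, E.τ_φ,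
        specMap_comp, specMap_comp]
      refine congrArg specMap ?_
      refine MvPolynomial.ringHom_ext (fun r => ?_) (fun k => ?_) <;> simp
    · rw [Category.assoc, IsPullback.lift_snd, pullback.lift_snd]
      exact (StrictEtaleNbhd.refl n R').τ_π.symm
  τ_ψ := by
    refine (affineSpace_isPullback f).hom_ext ?_ ?_
    · rw [Category.assoc, IsPullback.lift_fst, pullback.lift_fst_assoc, Category.assoc, E.τ_ψ,
        specMap_comp, specMap_comp]
      refine congrArg specMap ?_
      refine MvPolynomial.ringHom_ext (fun r => ?_) (fun k => ?_) <;> simp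
    · rw [Category.assoc, IsPullback.lift_snd, pullback.lift_snd]
      exact (StrictEtaleNbhd.refl n R').τ_π.symm

/-- The map `R⟦t⟧ ⧸ 𝔪 ^ (c + 1) → R'⟦t⟧ ⧸ 𝔪 ^ (c + 1)` induced by `f : R → R'`. -/
def jetBaseChange (n : ℕ) (f : R →+* R') (c : ℕ) : JetRing n R c →+* JetRing n R' c :=
  Ideal.quotientMap _ (MvPowerSeries.map f)
    (originIdeal_pow_le_comap _ (fun k => by simp) _)

lemma jetBaseChange_comp_toJet (f : R →+* R') (c : ℕ) :
    (jetBaseChange n f c).comp (toJet n R c) = (toJet n R' c).comp (MvPowerSeries.map f) :=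
  Ideal.quotientMap_comp_mk _

lemma StrictEtaleNbhd.Induces.baseChange {E : StrictEtaleNbhd n R} {ρ : discAut n R}
    (h : E.Induces ρ) (f : R →+* R') : (E.baseChange f).Induces (discAutMap f ρ) := fun c => by
  obtain ⟨ℓ, h1, h2, h3⟩ := h c
  have hπ : ℓ ≫ E.π = specMap ((toJet n R c).comp MvPowerSeries.C) := by
    rw [← E.ψ_proj, ← Category.assoc, h2, specMap_comp, RingHom.comp_assoc]
    refine congrArg specMap (congrArg (RingHom.comp (toJet n R c)) ?_)
    refine RingHom.ext fun r => ?_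
    simp
  have w : (specMap (jetBaseChange n f c) ≫ ℓ) ≫ E.π =
      specMap ((toJet n R' c).comp MvPowerSeries.C) ≫ specMap f := by
    rw [Category.assoc, hπ, specMap_comp, specMap_comp, ← RingHom.comp_assoc,
      jetBaseChange_comp_toJet]
    refine congrArg specMap ?_
    refine RingHom.ext fun r => ?_
    simp
  have hC : ∀ g : MvPowerSeries (Fin n) R' →+* MvPowerSeries (Fin n) R',
      (∀ r, g (MvPowerSeries.C r) = MvPowerSeries.C r) →
      specMap ((toJet n R' c).comp (g.comp (polyToSeries n R'))) ≫ affineProj n R' =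
        specMap ((toJet n R' c).comp MvPowerSeries.C) := fun g hg => by
    rw [specMap_comp]
    refine congrArg specMap ?_
    refine RingHom.ext fun r => ?_
    simp [hg]
  refine ⟨pullback.lift (specMap (jetBaseChange n f c) ≫ ℓ)
    (specMap ((toJet n R' c).comp MvPowerSeries.C)) w, ?_, ?_, ?_⟩
  · refine pullback.hom_ext ?_ ?_
    · rw [Category.assoc, pullback.lift_fst]
      refine Eq.trans ?_ (pullback.lift_fst _ _ _).symm
      rw [← h1, ← Category.assoc, ← Category.assoc, specMap_comp, specMap_comp]
      refine congrArg (fun q : JetRing n R c →+* R' => specMap q ≫ ℓ) ?_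
      refine Ideal.Quotient.ringHom_ext (RingHom.ext fun g => ?_)
      change MvPowerSeries.constantCoeff (MvPowerSeries.map f g) =
        f (MvPowerSeries.constantCoeff g)
      simp
    · rw [Category.assoc, pullback.lift_snd]
      refine Eq.trans ?_ (pullback.lift_snd _ _ _).symm
      rw [specMap_comp]
      have : (jetEval n R' c).comp ((toJet n R' c).comp MvPowerSeries.C) = RingHom.id R' :=
        RingHom.ext fun r =>
          (MvPowerSeries.constantCoeff_C r : MvPowerSeries.constantCoeff
            (MvPowerSeries.C r : MvPowerSeries (Fin n) R') = r)
      rw [this]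
      exact Spec.map_id _
  · refine (affineSpace_isPullback f).hom_ext ?_ ?_
    · rw [Category.assoc]
      refine (congrArg _ (IsPullback.lift_fst _ _ _ _)).trans ?_
      rw [pullback.lift_fst_assoc, Category.assoc, h2, specMap_comp, specMap_comp,
        ← RingHom.comp_assoc, jetBaseChange_comp_toJet]
      refine congrArg specMap ?_
      refine MvPolynomial.ringHom_ext (fun r => ?_) (fun k => ?_) <;> simp
    · rw [Category.assoc]
      refine (congrArg _ (IsPullback.lift_snd _ _ _ _)).trans ?_
      rw [pullback.lift_snd]
      exact (hC (RingHom.id _) fun _ => rfl).symm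
  · refine (affineSpace_isPullback f).hom_ext ?_ ?_
    · rw [Category.assoc]
      refine (congrArg _ (IsPullback.lift_fst _ _ _ _)).trans ?_
      rw [pullback.lift_fst_assoc, Category.assoc, h3, specMap_comp, specMap_comp,
        ← RingHom.comp_assoc, jetBaseChange_comp_toJet]
      refine congrArg specMap ?_
      refine MvPolynomial.ringHom_ext (fun r => ?_) (fun k => ?_)
      · have e1 : ρ.1 (MvPowerSeries.C r) = MvPowerSeries.C r := ρ.1.commutes r
        have e2 : (discAutMap f ρ).1 (MvPowerSeries.C (f r)) = MvPowerSeries.C (f r) :=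
          (discAutMap f ρ).1.commutes (f r)
        simp [e1, e2]
      · simp [discAutMap_X]
    · rw [Category.assoc]
      refine (congrArg _ (IsPullback.lift_snd _ _ _ _)).trans ?_
      rw [pullback.lift_snd]
      exact (hC _ fun r => (discAutMap f ρ).1.commutes r).symm

/-- The homomorphism `K^ét(R) → K^ét(R')`, the restriction of `K(R) → K(R')`. -/
def etaleAutMap (f : R →+* R') : etaleAut n R →* etaleAut n R' :=
  ((discAutMap f).comp (etaleAut n R).subtype).codRestrict (etaleAut n R')
    fun ρ => ρ.2.imp' (fun E => E.baseChange f) fun _ h => h.baseChange f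

end BaseChangeNbhd

end FormalDisc

/-! ### Group-valued prestacks and their representations -/

/-- A group-valued prestack over `k`: a functor from (affine `k`-schemes)ᵒᵖ, i.e. commutative
`k`-algebras, to groups. -/
abbrev GroupPrestack (k : Type u) [Field k] := CommAlgCat.{u} k ⥤ GrpCat.{u}

namespace GroupPrestack

variable {k : Type u} [Field k]

/-- A representation of a group-valued prestack `H` on a `k`-vector space `V`: homomorphisms
`H(R) → GL(R ⊗ₖ V)`, natural in the `k`-algebra `R`. (The base change to `R'` of an automorphism
of `R ⊗ₖ V` is the unique automorphism of `R' ⊗ₖ V` compatible with it along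
`R ⊗ₖ V → R' ⊗ₖ V`, so `natural` is the naturality of `H ⟶ GL_V`.) -/
structure Representation (H : GroupPrestack k) where
  V : Type u
  [addCommGroup : AddCommGroup V]
  [module : Module k V]
  ρ : ∀ R : CommAlgCat.{u} k, H.obj R →* (R ⊗[k] V ≃ₗ[R] R ⊗[k] V)
  natural : ∀ {R R' : CommAlgCat.{u} k} (f : R ⟶ R') (g : H.obj R) (x : R ⊗[k] V),
    f.hom.toLinearMap.rTensor V (ρ R g x) = ρ R' (H.map f g) (f.hom.toLinearMap.rTensor V x)

namespace Representation

attribute [instance] addCommGroup module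

variable {H : GroupPrestack k}

/-- A morphism of representations: a `k`-linear map which after base change to any `R` commutes
with the action of `H(R)`. -/
@[ext]
structure Hom (A B : Representation H) where
  toLin : A.V →ₗ[k] B.V
  equivariant : ∀ (R : CommAlgCat.{u} k) (g : H.obj R) (x : R ⊗[k] A.V),
    toLin.baseChange R (A.ρ R g x) = B.ρ R g (toLin.baseChange R x)

/-- The category `Rep(H)`. -/
instance : Category (Representation H) where
  Hom := Hom
  id A := ⟨LinearMap.id, fun R g x => by simp⟩
  comp f g := ⟨g.toLin ∘ₗ f.toLin, fun R h x => by
    simp only [LinearMap.baseChange_comp, LinearMap.comp_apply, f.equivariant, g.equivariant]⟩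

/-- Restriction of representations along a homomorphism `ι : H' ⟶ H` of group-valued prestacks. -/
def res {H' : GroupPrestack k} (ι : H' ⟶ H) : Representation H ⥤ Representation H' where
  obj A :=
    { V := A.V
      ρ := fun R => (A.ρ R).comp (ι.app R).hom
      natural := fun {R R'} f g x => by
        have e : ι.app R' (H'.map f g) = H.map f (ι.app R g) :=
          ConcreteCategory.congr_hom (ι.naturality f) g
        change _ = A.ρ R' (ι.app R' (H'.map f g)) _
        rw [e]
        exact A.natural f (ι.app R g) x }
  map {A B} F := ⟨F.toLin, fun R g x => F.equivariant R (ι.app R g) x⟩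

/-- A subspace `W ⊆ V` is a subrepresentation if `R ⊗ₖ W` is stable under `H(R)` for every `R`. -/
def IsSubrep (A : Representation H) (W : Submodule k A.V) : Prop :=
  ∀ (R : CommAlgCat.{u} k) (g : H.obj R), ∀ x ∈ W.baseChange R, A.ρ R g x ∈ W.baseChange R

/-- Locally finite representations: every vector lies in a finite-dimensional
subrepresentation. -/
def IsLocallyFinite : ObjectProperty (Representation H) := fun A =>
  ∀ v : A.V, ∃ W : Submodule k A.V, A.IsSubrep W ∧ FiniteDimensional k W ∧ v ∈ W

end Representation

end GroupPrestack

namespace FormalDisc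

variable (k : Type u) [Field k] (n : ℕ)

/-- The group-valued prestack `K` of automorphisms of the formal `n`-disc fixing the origin. -/
def K : GroupPrestack k where
  obj R := GrpCat.of (discAut n R)
  map f := GrpCat.ofHom (discAutMap f.hom.toRingHom)
  map_id _ := GrpCat.hom_ext (MonoidHom.ext fun ρ => discAutMap_id ρ)
  map_comp f g := GrpCat.hom_ext (MonoidHom.ext fun ρ =>
    discAutMap_comp f.hom.toRingHom g.hom.toRingHom ρ)

/-- The group-valued prestack `K^ét` of étale automorphisms of the formal `n`-disc. -/
def KEt : GroupPrestack k where
  obj R := GrpCat.of (etaleAut n R)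
  map f := GrpCat.ofHom (etaleAutMap f.hom.toRingHom)
  map_id _ := GrpCat.hom_ext (MonoidHom.ext fun ρ => Subtype.ext (discAutMap_id ρ.1))
  map_comp f g := GrpCat.hom_ext (MonoidHom.ext fun ρ => Subtype.ext
    (discAutMap_comp f.hom.toRingHom g.hom.toRingHom ρ.1))

/-- The inclusion `K^ét ⟶ K`. -/
def KEtIncl : KEt k n ⟶ K k n where
  app R := GrpCat.ofHom (etaleAut n R).subtype
  naturality _ _ _ := rfl

end FormalDisc

end

/-!
Write `K` for the prestack of all automorphisms of the formal disc and `K^ét` for the étale ones. An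
element of `K(R)` has the same `c`-jet as an element of `K^ét(R)`, for every `c`: truncate the power
series that define it; a polynomial automorphism is étale near the origin
(`exists_etaleAut_jetCongr`). So everything follows once it is known that, in a locally finite
representation of `K` or of `K^ét` on `V`, the action of `g` on a given `x ∈ R ⊗ V` depends only on a
finite jet of `g` (`IsDilatable.exists_jet_bound_tensor`). Representations of `K` are all locally
finite, because `K` has a versal element, with indeterminate coefficients, over a single ring
(`isLocallyFinite_of_versal`, `exists_versal`).

A bound on the order of the jet is obtained by dilation. The dilation of `h ∈ K(R)` is the
automorphism `h'(t) = λ⁻¹ h(λ t)` over `R[λ]`. Its value at `λ = 1` is `h`; over `R[λ, λ⁻¹]` it is the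
conjugate `s h s⁻¹` by the scaling `s`; and it is the identity modulo `λ ^ c` if `h` is the identity up
to order `c`. Let `v` lie in a finite-dimensional subrepresentation `W`. Then `s⁻¹ v` is a combination
of vectors of `W` with coefficients in `k[λ, λ⁻¹]`, `h` keeps it in `R[λ, λ⁻¹] ⊗ W` without raising
degrees in `λ`, and `s` raises the degrees of elements of `R ⊗ W` by a bounded amount. Hence the degree
in `λ` of `h' v = s h s⁻¹ v` is at most some `N ≥ 0` that does not depend on `R` and `h`
(`exists_conj_mem_degreeLE`). If `c > N`, then `h' v - v`, which is divisible by `λ ^ c`, vanishes, and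
`λ = 1` gives `h v = v` (`IsDilatable.exists_bound_of_dilate`).

For this to apply to `K^ét`, dilations of étale automorphisms have to be étale. The equality
`h v = v` may be checked locally on `Spec R`, so the common étale neighbourhood may be assumed to be
affine (`StrictEtaleNbhd.Induces.exists_realizes`): there are étale coordinates `y` on an algebra `B`,
and functions `z` in the ideal of the section whose expansions in `y` are the series `h(t_k)`. Near the
section `z = ∑ a y`, since `y` generates that ideal there. Pulling `B` back along the map
`x ↦ λ x` of affine spaces gives étale coordinates `x` with `y = λ x`, and the functions `∑ a x`, whose
product with `λ` is `z`, realize the dilation (`Realizes.dilate_mem_etaleAut`). They are étale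
coordinates near the section by the Jacobian criterion (`etale_of_isUnit_det`,
`Realizes.mem_etaleAut_of_sum`).
-/

noncomputable section

namespace FormalDisc

/-! ### Power series and the inverse function theorem -/

section PowerSeries

variable {n : ℕ} {R : Type u} [CommRing R]

/-- A power series of order at least `c + 1` is a combination of the variables with coefficients of
order at least `c`. -/
lemma exists_eq_sum_X_mul (f : MvPowerSeries (Fin n) R) (c : ℕ)
    (hf : ∀ d : Fin n →₀ ℕ, d.degree < c + 1 → MvPowerSeries.coeff d f = 0) :
    ∃ g : Fin n → MvPowerSeries (Fin n) R, f = ∑ k, g k * MvPowerSeries.X k ∧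
      ∀ k (d : Fin n →₀ ℕ), d.degree < c → MvPowerSeries.coeff d (g k) = 0 := by
  classical
  have key : ∀ d : Fin n →₀ ℕ, d ≠ 0 → ∃ k, d k ≠ 0 := fun d hd => by
    by_contra! h
    exact hd (Finsupp.ext h)
  choose i hi using key
  -- each monomial of `f` is assigned to one of the variables that divide it
  let p : Fin n → MvPowerSeries (Fin n) R := fun k d =>
    if ∃ h : d ≠ 0, i d h = k then MvPowerSeries.coeff d f else 0
  have hp : ∀ k d, MvPowerSeries.coeff d (p k) =
      if ∃ h : d ≠ 0, i d h = k then MvPowerSeries.coeff d f else 0 := fun k d => rfl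
  have hsum : f = ∑ k, p k := by
    ext d
    rw [map_sum]
    simp only [hp]
    by_cases hd : d = 0
    · subst hd
      simpa using hf 0 (by simp)
    · simp [hd]
  have hdvd : ∀ k, MvPowerSeries.X k ∣ p k := fun k => by
    rw [MvPowerSeries.X_dvd_iff]
    intro d hd
    rw [hp, if_neg]
    rintro ⟨h0, rfl⟩
    exact hi d h0 hd
  choose g hg using hdvd
  refine ⟨g, ?_, fun k d hd => ?_⟩
  · conv_lhs => rw [hsum]
    exact Finset.sum_congr rfl fun k _ => by rw [hg k, mul_comm]
  · have h1 : MvPowerSeries.coeff (d + Finsupp.single k 1) (p k) = MvPowerSeries.coeff d (g k) := by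
      rw [hg k, mul_comm, MvPowerSeries.X, MvPowerSeries.coeff_add_mul_monomial, mul_one]
    rw [← h1, hp, hf _ (by simpa using hd), ite_self]

lemma mem_originIdeal_pow_iff {c : ℕ} {f : MvPowerSeries (Fin n) R} :
    f ∈ originIdeal n R ^ c ↔
      ∀ d : Fin n →₀ ℕ, d.degree < c → MvPowerSeries.coeff d f = 0 := by
  refine ⟨fun h d hd => MvPowerSeries.coeff_of_lt_order
    (lt_of_lt_of_le (by exact_mod_cast hd) (le_order_of_mem_pow c h)), fun h => ?_⟩
  induction c generalizing f with
  | zero => simp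
  | succ c ih =>
    obtain ⟨g, hg, hg'⟩ := exists_eq_sum_X_mul f c h
    rw [hg, pow_succ]
    exact Ideal.sum_mem _ fun k _ =>
      Ideal.mul_mem_mul (ih (hg' k)) (Ideal.subset_span ⟨k, rfl⟩)

lemma coeff_single_mul (j : Fin n) (f g : MvPowerSeries (Fin n) R) :
    MvPowerSeries.coeff (Finsupp.single j 1) (f * g) =
      MvPowerSeries.coeff (Finsupp.single j 1) f * MvPowerSeries.constantCoeff g +
      MvPowerSeries.constantCoeff f * MvPowerSeries.coeff (Finsupp.single j 1) g := by
  classical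
  have h : Finset.HasAntidiagonal.antidiagonal (1 : ℕ) = {(0, 1), (1, 0)} := rfl
  rw [MvPowerSeries.coeff_mul, Finsupp.antidiagonal_single, Finset.sum_map, h,
    Finset.sum_pair (by simp), add_comm]
  simp

/-- The Jacobian matrix at the origin of a tuple of power series. -/
def linearPart (a : Fin n → MvPowerSeries (Fin n) R) : Matrix (Fin n) (Fin n) R :=
  Matrix.of fun k j => MvPowerSeries.coeff (Finsupp.single j 1) (a k)

lemma linearPart_apply (a : Fin n → MvPowerSeries (Fin n) R) (k j : Fin n) :
    linearPart a k j = MvPowerSeries.coeff (Finsupp.single j 1) (a k) := rfl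

lemma linearPart_sum_mul (a : Fin n → MvPowerSeries (Fin n) R)
    (h : Fin n → Fin n → MvPowerSeries (Fin n) R)
    (ha : ∀ k, MvPowerSeries.constantCoeff (a k) = 0) :
    linearPart (fun k => ∑ i, h k i * a i) =
      (Matrix.of fun k j => MvPowerSeries.constantCoeff (h k j)) * linearPart a := by
  ext k j
  simp [linearPart_apply, Matrix.mul_apply, coeff_single_mul, ha]

lemma linearPart_X : linearPart (fun k => (MvPowerSeries.X k : MvPowerSeries (Fin n) R)) = 1 := by
  classical
  ext k j
  rw [linearPart_apply, MvPowerSeries.coeff_X, Matrix.one_apply]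
  simp [Finsupp.single_left_inj, eq_comm]

/-- Chain rule at the origin. -/
lemma linearPart_algHom (F : MvPowerSeries (Fin n) R →ₐ[R] MvPowerSeries (Fin n) R)
    (hF : ∀ k, MvPowerSeries.constantCoeff (F (MvPowerSeries.X k)) = 0)
    (a : Fin n → MvPowerSeries (Fin n) R) (ha : ∀ k, MvPowerSeries.constantCoeff (a k) = 0) :
    linearPart (fun k => F (a k)) =
      linearPart a * linearPart fun k => F (MvPowerSeries.X k) := by
  have h1 : ∀ k, ∃ g : Fin n → MvPowerSeries (Fin n) R, a k = ∑ i, g i * MvPowerSeries.X i :=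
    fun k => by
      obtain ⟨g, hg, -⟩ := exists_eq_sum_X_mul (a k) 0 fun d hd => by
        have : d = 0 := (Finsupp.degree_eq_zero_iff d).1 (by simpa using hd)
        subst this
        simpa using ha k
      exact ⟨g, hg⟩
  choose g hg using h1
  have e1 : linearPart a = Matrix.of fun k j => MvPowerSeries.constantCoeff (g k j) := by
    rw [funext hg, linearPart_sum_mul _ _ (by simp), linearPart_X, mul_one]
  have e2 : (fun k => F (a k)) = fun k => ∑ i, F (g k i) * F (MvPowerSeries.X i) := by
    funext k
    conv_lhs => rw [hg k]
    simp
  rw [e1, e2, linearPart_sum_mul _ _ hF]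
  simp only [constantCoeff_algHom hF]

lemma isUnit_det_linearPart (ρ : discAut n R) :
    IsUnit (linearPart fun k => ρ.1 (MvPowerSeries.X k)).det := by
  have h := linearPart_algHom ρ.1.toAlgHom ρ.2 (fun k => (ρ⁻¹).1 (MvPowerSeries.X k)) (ρ⁻¹).2
  have e : (fun k => ρ.1.toAlgHom ((ρ⁻¹).1 (MvPowerSeries.X k))) =
      fun k => (MvPowerSeries.X k : MvPowerSeries (Fin n) R) :=
    funext fun k => AlgEquiv.apply_symm_apply ρ.1 _
  rw [e, linearPart_X] at h
  have h2 := congrArg Matrix.det h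
  rw [Matrix.det_one, Matrix.det_mul] at h2
  exact IsUnit.of_mul_eq_one _ ((mul_comm _ _).trans h2.symm)

section AlgHom

variable (F : MvPowerSeries (Fin n) R →ₐ[R] MvPowerSeries (Fin n) R)

lemma map_sub_self_mem (hF : ∀ k, F (MvPowerSeries.X k) - MvPowerSeries.X k ∈ originIdeal n R ^ 2)
    (c : ℕ) {f : MvPowerSeries (Fin n) R} (hf : f ∈ originIdeal n R ^ c) :
    F f - f ∈ originIdeal n R ^ (c + 1) := by
  have hF0 : ∀ k, F (MvPowerSeries.X k) ∈ originIdeal n R := fun k => by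
    have := Ideal.add_mem _ (Ideal.pow_le_self two_ne_zero (hF k))
      (Ideal.subset_span ⟨k, rfl⟩ : MvPowerSeries.X k ∈ originIdeal n R)
    simpa using this
  have hF1 : ∀ k, MvPowerSeries.constantCoeff (F (MvPowerSeries.X k)) = 0 :=
    fun k => mem_originIdeal_iff.1 (hF0 k)
  induction c generalizing f with
  | zero =>
    rw [zero_add, pow_one, mem_originIdeal_iff, map_sub, constantCoeff_algHom hF1, sub_self]
  | succ c ih =>
    obtain ⟨g, hg, hg'⟩ := exists_eq_sum_X_mul f c (mem_originIdeal_pow_iff.1 hf)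
    have hg'' : ∀ k, g k ∈ originIdeal n R ^ c := fun k => mem_originIdeal_pow_iff.2 (hg' k)
    have e : F f - f = ∑ k, ((F (g k) - g k) * F (MvPowerSeries.X k) +
        g k * (F (MvPowerSeries.X k) - MvPowerSeries.X k)) := by
      conv_lhs => rw [hg]
      rw [map_sum, ← Finset.sum_sub_distrib]
      refine Finset.sum_congr rfl fun k _ => ?_
      rw [map_mul]; ring
    rw [e]
    refine Ideal.sum_mem _ fun k _ => Ideal.add_mem _ ?_ ?_
    · rw [pow_succ]
      exact Ideal.mul_mem_mul (ih (hg'' k)) (hF0 k)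
    · rw [show c + 1 + 1 = c + 2 from rfl, pow_add]
      exact Ideal.mul_mem_mul (hg'' k) (hF k)

lemma eq_of_forall_sub_mem {f g : MvPowerSeries (Fin n) R}
    (h : ∀ c, f - g ∈ originIdeal n R ^ c) : f = g := by
  ext d
  have := mem_originIdeal_pow_iff.1 (h (d.degree + 1)) d (Nat.lt_succ_self _)
  rwa [map_sub, sub_eq_zero] at this

/-- An endomorphism that is the identity to first order is bijective: a preimage of `f` is
`∑ i, (1 - F) ^ i f`. -/
lemma bijective_of_sub_mem
    (hF : ∀ k, F (MvPowerSeries.X k) - MvPowerSeries.X k ∈ originIdeal n R ^ 2) :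
    Function.Bijective F := by
  constructor
  · refine (injective_iff_map_eq_zero F).2 fun f hf => eq_of_forall_sub_mem fun c => ?_
    rw [sub_zero]
    induction c with
    | zero => simp
    | succ c ih =>
      have := map_sub_self_mem F hF c ih
      rw [hf, zero_sub] at this
      exact neg_mem_iff.1 this
  · intro f
    let N : ℕ → MvPowerSeries (Fin n) R := fun i => (fun g => g - F g)^[i] f
    have hNs : ∀ i, N (i + 1) = N i - F (N i) := fun i => Function.iterate_succ_apply' _ _ _
    have hN : ∀ i, N i ∈ originIdeal n R ^ i := fun i => by
      induction i with
      | zero => simp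
      | succ i ih =>
        rw [hNs, ← neg_sub]
        exact neg_mem (map_sub_self_mem F hF i ih)
    have hFsum : ∀ c, F (∑ i ∈ Finset.range c, N i) = f - N c := fun c => by
      rw [map_sum]
      have : ∀ i, F (N i) = N i - N (i + 1) := fun i => by rw [hNs]; ring
      rw [Finset.sum_congr rfl fun i _ => this i, Finset.sum_range_sub']
      rfl
    let g : MvPowerSeries (Fin n) R := fun d =>
      MvPowerSeries.coeff d (∑ i ∈ Finset.range (d.degree + 1), N i)
    have hg : ∀ c, g - ∑ i ∈ Finset.range c, N i ∈ originIdeal n R ^ c := fun c => by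
      rw [mem_originIdeal_pow_iff]
      intro d hd
      have e : MvPowerSeries.coeff d g =
        MvPowerSeries.coeff d (∑ i ∈ Finset.range (d.degree + 1), N i) := rfl
      rw [map_sub, e, ← Finset.sum_range_add_sum_Ico _ (Nat.succ_le_of_lt hd), ← map_sub,
        Nat.succ_eq_add_one, sub_add_cancel_left, map_neg, map_sum, neg_eq_zero]
      refine Finset.sum_eq_zero fun i hi => ?_
      exact mem_originIdeal_pow_iff.1 (hN i) d (Nat.lt_of_succ_le (Finset.mem_Ico.1 hi).1)
    have hF1 : ∀ k, MvPowerSeries.constantCoeff (F (MvPowerSeries.X k)) = 0 := fun k => by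
      have := Ideal.add_mem _ (Ideal.pow_le_self two_ne_zero (hF k))
        (Ideal.subset_span ⟨k, rfl⟩ : MvPowerSeries.X k ∈ originIdeal n R)
      exact mem_originIdeal_iff.1 (by simpa using this)
    refine ⟨g, eq_of_forall_sub_mem fun c => ?_⟩
    have h1 := originIdeal_pow_le_comap F.toRingHom hF1 c (hg c)
    have h2 : F g - f = F (g - ∑ i ∈ Finset.range c, N i) - N c := by
      rw [map_sub, hFsum]; ring
    rw [h2]
    exact sub_mem h1 (hN c)

end AlgHom

/-- Inverse function theorem: power series without constant term and with invertible Jacobian at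
the origin are the images of the variables under an automorphism. -/
theorem exists_discAut (a : Fin n → MvPowerSeries (Fin n) R)
    (ha : ∀ k, MvPowerSeries.constantCoeff (a k) = 0) (hdet : IsUnit (linearPart a).det) :
    ∃ ρ : discAut n R, ∀ k, ρ.1 (MvPowerSeries.X k) = a k := by
  classical
  -- linear substitutions
  let lin : Matrix (Fin n) (Fin n) R → Fin n → MvPowerSeries (Fin n) R :=
    fun M k => ∑ j, MvPowerSeries.C (M k j) * MvPowerSeries.X j
  have hlin0 : ∀ M k, MvPowerSeries.constantCoeff (lin M k) = 0 := fun M k => by simp [lin]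
  let L : Matrix (Fin n) (Fin n) R → MvPowerSeries (Fin n) R →ₐ[R] MvPowerSeries (Fin n) R :=
    fun M => MvPowerSeries.substAlgHom (MvPowerSeries.hasSubst_of_constantCoeff_zero (hlin0 M))
  have hLX : ∀ M k, L M (MvPowerSeries.X k) = lin M k := fun M k => MvPowerSeries.substAlgHom_X _ k
  have hLL : ∀ M N, M * N = 1 → (L N).comp (L M) = AlgHom.id R _ := fun M N h => by
    have hX : ∀ k, (L N).comp (L M) (MvPowerSeries.X k) = MvPowerSeries.X k := fun k => by
      rw [AlgHom.comp_apply, hLX]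
      have hC : ∀ r : R, L N (MvPowerSeries.C r) = MvPowerSeries.C r := (L N).commutes
      simp only [lin, map_sum, map_mul, hC, hLX, Finset.mul_sum]
      rw [Finset.sum_comm]
      have : ∀ j, ∑ i, MvPowerSeries.C (M k i) * (MvPowerSeries.C (N i j) * MvPowerSeries.X j) =
          MvPowerSeries.C ((M * N) k j) * (MvPowerSeries.X j : MvPowerSeries (Fin n) R) := fun j => by
        rw [Matrix.mul_apply, map_sum, Finset.sum_mul]
        exact Finset.sum_congr rfl fun i _ => by rw [map_mul, mul_assoc]
      simp only [this, h, Matrix.one_apply]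
      simp
    exact algHom_ext_of_X (fun k => by rw [hX]; simp) hX
  let F : MvPowerSeries (Fin n) R →ₐ[R] MvPowerSeries (Fin n) R :=
    MvPowerSeries.substAlgHom (MvPowerSeries.hasSubst_of_constantCoeff_zero ha)
  have hFX : ∀ k, F (MvPowerSeries.X k) = a k := fun k => MvPowerSeries.substAlgHom_X _ k
  let A := linearPart a
  have hA1 : A * A⁻¹ = 1 := Matrix.mul_nonsing_inv A hdet
  have hA2 : A⁻¹ * A = 1 := Matrix.nonsing_inv_mul A hdet
  have hLbij : Function.Bijective (L A⁻¹) :=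
    Function.bijective_iff_has_inverse.2 ⟨L A, fun f => DFunLike.congr_fun (hLL _ _ hA2) f,
      fun f => DFunLike.congr_fun (hLL _ _ hA1) f⟩
  have hF0 : ∀ k, MvPowerSeries.constantCoeff (F (MvPowerSeries.X k)) = 0 := fun k => by
    rw [hFX, ha]
  have hlp : linearPart (fun k => F (L A⁻¹ (MvPowerSeries.X k))) = 1 := by
    rw [linearPart_algHom F hF0 _ (fun k => by rw [hLX, hlin0])]
    simp only [hLX, hFX, lin]
    rw [linearPart_sum_mul _ _ (by simp), linearPart_X]
    simp only [MvPowerSeries.constantCoeff_C, mul_one]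
    exact hA2
  have hFL : Function.Bijective (F.comp (L A⁻¹)) := by
    refine bijective_of_sub_mem _ fun k => mem_originIdeal_pow_iff.2 fun d hd => ?_
    rcases Nat.lt_succ_iff_lt_or_eq.1 hd with h0 | h1
    · have : d = 0 := (Finsupp.degree_eq_zero_iff d).1 (by simpa using h0)
      subst this
      have : MvPowerSeries.constantCoeff (F (L A⁻¹ (MvPowerSeries.X k))) = 0 := by
        rw [constantCoeff_algHom hF0, hLX, hlin0]
      simp [this]
    · obtain ⟨j, rfl⟩ := (Finsupp.range_single_one (σ := Fin n)).ge h1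
      have := congrFun (congrFun (hlp.trans linearPart_X.symm) k) j
      rw [linearPart_apply, linearPart_apply] at this
      rw [map_sub, sub_eq_zero]
      exact this
  have hFbij : Function.Bijective F := (Function.Bijective.of_comp_iff F hLbij).1 hFL
  exact ⟨⟨AlgEquiv.ofBijective F hFbij, hF0⟩, hFX⟩

end PowerSeries

/-! ### Congruence of automorphisms modulo powers of the maximal ideal -/

section Congruence

variable {n : ℕ} {R R' : Type u} [CommRing R] [CommRing R']

/-- Two automorphisms of the formal disc have the same `c`-jet, i.e. they induce the same
automorphism of `R⟦t⟧ ⧸ 𝔪 ^ (c + 1)`. -/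
def JetCongr (c : ℕ) (ρ σ : discAut n R) : Prop :=
  ∀ f, ρ.1 f - σ.1 f ∈ originIdeal n R ^ (c + 1)

lemma discAut_mem_originIdeal_pow (ρ : discAut n R) {c : ℕ} {f : MvPowerSeries (Fin n) R}
    (hf : f ∈ originIdeal n R ^ c) : ρ.1 f ∈ originIdeal n R ^ c :=
  originIdeal_pow_le_comap (ρ.1 : MvPowerSeries (Fin n) R →+* MvPowerSeries (Fin n) R) ρ.2 c hf

lemma jetCongr_of_X {c : ℕ} {ρ σ : discAut n R}
    (h : ∀ k, ρ.1 (MvPowerSeries.X k) - σ.1 (MvPowerSeries.X k) ∈ originIdeal n R ^ (c + 1)) :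
    JetCongr c ρ σ := by
  have key : ∀ (b : ℕ), b ≤ c + 1 → ∀ (f : MvPowerSeries (Fin n) R),
      ρ.1 f - σ.1 f ∈ originIdeal n R ^ b := by
    intro b
    induction b with
    | zero => intro _ f; simp
    | succ b ih =>
      intro hb f
      have hf : f - MvPowerSeries.C (MvPowerSeries.constantCoeff f) ∈ originIdeal n R := by
        rw [mem_originIdeal_iff]; simp
      obtain ⟨a, ha⟩ := (Ideal.mem_span_range_iff_exists_fun).1 hf
      have hC : ∀ r : R, ρ.1 (MvPowerSeries.C r) = σ.1 (MvPowerSeries.C r) := fun r =>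
        (ρ.1.commutes r).trans (σ.1.commutes r).symm
      have hf' : ρ.1 f - σ.1 f = ∑ k, ((ρ.1 (a k) - σ.1 (a k)) * ρ.1 (MvPowerSeries.X k) +
          σ.1 (a k) * (ρ.1 (MvPowerSeries.X k) - σ.1 (MvPowerSeries.X k))) := by
        have e : f = (∑ k, a k * MvPowerSeries.X k) +
            MvPowerSeries.C (MvPowerSeries.constantCoeff f) := by rw [ha]; ring
        conv_lhs => rw [e]
        simp only [map_add, map_sum, map_mul, hC]
        rw [add_sub_add_right_eq_sub, ← Finset.sum_sub_distrib]
        exact Finset.sum_congr rfl fun k _ => by ring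
      rw [hf']
      refine Ideal.sum_mem _ fun k _ => Ideal.add_mem _ ?_ ?_
      · rw [pow_succ]
        exact Ideal.mul_mem_mul (ih (by omega) _) (mem_originIdeal_iff.2 (ρ.2 k))
      · exact Ideal.mul_mem_left _ _ (Ideal.pow_le_pow_right hb (h k))
  exact key _ le_rfl

lemma JetCongr.symm {c : ℕ} {ρ σ : discAut n R} (h : JetCongr c ρ σ) : JetCongr c σ ρ := fun f => by
  rw [← neg_sub]
  exact neg_mem (h f)

lemma JetCongr.trans {c : ℕ} {ρ σ τ : discAut n R} (h : JetCongr c ρ σ) (h' : JetCongr c σ τ) :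
    JetCongr c ρ τ := fun f => by
  rw [← sub_add_sub_cancel]
  exact add_mem (h f) (h' f)

lemma JetCongr.mono {b c : ℕ} (hbc : b ≤ c) {ρ σ : discAut n R} (h : JetCongr c ρ σ) :
    JetCongr b ρ σ := fun f => Ideal.pow_le_pow_right (by omega) (h f)

lemma JetCongr.mul {c : ℕ} {ρ σ ρ' σ' : discAut n R} (h : JetCongr c ρ σ)
    (h' : JetCongr c ρ' σ') : JetCongr c (ρ * ρ') (σ * σ') := fun f => by
  have e : (ρ * ρ').1 f - (σ * σ').1 f =
      (ρ.1 (ρ'.1 f) - σ.1 (ρ'.1 f)) + σ.1 (ρ'.1 f - σ'.1 f) := by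
    rw [map_sub]
    change ρ.1 (ρ'.1 f) - σ.1 (σ'.1 f) = _
    ring
  rw [e]
  exact add_mem (h _) (discAut_mem_originIdeal_pow σ (h' f))

lemma JetCongr.inv_mul {c : ℕ} {ρ σ : discAut n R} (h : JetCongr c ρ σ) :
    JetCongr c (ρ⁻¹ * σ) 1 := by
  have : JetCongr c (ρ⁻¹ * σ) (ρ⁻¹ * ρ) := JetCongr.mul (fun f => by simp) h.symm
  rwa [inv_mul_cancel] at this

lemma JetCongr.map {c : ℕ} {ρ σ : discAut n R} (h : JetCongr c ρ σ) (f : R →+* R') :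
    JetCongr c (discAutMap f ρ) (discAutMap f σ) := jetCongr_of_X fun k => by
  rw [discAutMap_X, discAutMap_X, ← map_sub]
  exact originIdeal_pow_le_comap _ (fun k => by simp) _ (h _)

end Congruence

/-! ### Dilation -/

section Dilation

variable {n : ℕ} {R R' : Type u} [CommRing R] [CommRing R']

/-- `λ⁻¹ f(λ t)`, for a power series `f` over `R` without constant term, as a power series over
`R[λ]`. -/
def dilateSeries (f : MvPowerSeries (Fin n) R) : MvPowerSeries (Fin n) (Polynomial R) :=
  fun d => Polynomial.monomial (d.degree - 1) (MvPowerSeries.coeff d f)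

lemma coeff_dilateSeries (f : MvPowerSeries (Fin n) R) (d : Fin n →₀ ℕ) :
    MvPowerSeries.coeff d (dilateSeries f) =
      Polynomial.monomial (d.degree - 1) (MvPowerSeries.coeff d f) := rfl

/-- The substitution `t ↦ λ t`, from `R⟦t⟧` to `R[λ]⟦t⟧`. -/
def scaleHom (n : ℕ) (R : Type u) [CommRing R] :
    MvPowerSeries (Fin n) R →+* MvPowerSeries (Fin n) (Polynomial R) :=
  (MvPowerSeries.rescale fun _ => Polynomial.X).comp (MvPowerSeries.map Polynomial.C)

lemma prod_const_pow (d : Fin n →₀ ℕ) (r : R) : (d.prod fun _ m => r ^ m) = r ^ d.degree := by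
  rw [Finsupp.prod, Finset.prod_pow_eq_pow_sum]
  rfl

lemma coeff_scaleHom (f : MvPowerSeries (Fin n) R) (d : Fin n →₀ ℕ) :
    MvPowerSeries.coeff d (scaleHom n R f) =
      Polynomial.X ^ d.degree * Polynomial.C (MvPowerSeries.coeff d f) := by
  rw [scaleHom, RingHom.comp_apply, MvPowerSeries.coeff_rescale, prod_const_pow,
    MvPowerSeries.coeff_map]

lemma scaleHom_X (k : Fin n) :
    scaleHom n R (MvPowerSeries.X k) = MvPowerSeries.C Polynomial.X * MvPowerSeries.X k := by
  classical
  ext1 d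
  rw [coeff_scaleHom, MvPowerSeries.coeff_C_mul, MvPowerSeries.coeff_X, MvPowerSeries.coeff_X]
  split_ifs with h
  · subst h; simp
  · simp

lemma scaleHom_C (r : R) :
    scaleHom n R (MvPowerSeries.C r) = MvPowerSeries.C (Polynomial.C r) := by
  classical
  ext1 d
  rw [coeff_scaleHom, MvPowerSeries.coeff_C, MvPowerSeries.coeff_C]
  split_ifs with h
  · subst h; simp
  · simp

lemma C_X_mul_dilateSeries {f : MvPowerSeries (Fin n) R}
    (hf : MvPowerSeries.constantCoeff f = 0) :
    MvPowerSeries.C Polynomial.X * dilateSeries f = scaleHom n R f := by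
  ext1 d
  rw [coeff_scaleHom, MvPowerSeries.coeff_C_mul, coeff_dilateSeries]
  by_cases hd : d = 0
  · subst hd; simp [hf]
  · have : d.degree ≠ 0 := fun h => hd ((Finsupp.degree_eq_zero_iff d).1 h)
    rw [← Polynomial.C_mul_X_pow_eq_monomial, mul_left_comm, mul_pow_sub_one this, mul_comm]

/-- The automorphism `λ⁻¹ ρ(λ t)` over `R[λ]`. -/
lemma exists_dilate (ρ : discAut n R) : ∃ ρ' : discAut n (Polynomial R),
    ∀ k, ρ'.1 (MvPowerSeries.X k) = dilateSeries (ρ.1 (MvPowerSeries.X k)) := by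
  refine exists_discAut _ (fun k => ?_) ?_
  · rw [← MvPowerSeries.coeff_zero_eq_constantCoeff_apply, coeff_dilateSeries]
    have h : MvPowerSeries.constantCoeff (ρ.1 (MvPowerSeries.X k)) = 0 := ρ.2 k
    simp [h]
  · have e : linearPart (fun k => dilateSeries (ρ.1 (MvPowerSeries.X k))) =
        (linearPart fun k => ρ.1 (MvPowerSeries.X k)).map Polynomial.C := by
      ext1 k j
      rw [linearPart_apply, coeff_dilateSeries, Matrix.map_apply, linearPart_apply]
      simp
    rw [e, ← RingHom.mapMatrix_apply, ← RingHom.map_det]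
    exact (isUnit_det_linearPart ρ).map _

/-- The dilation of an automorphism `ρ` of the formal disc over `R`: the automorphism `λ⁻¹ ρ(λ t)`
over `R[λ]`. -/
def dilate (ρ : discAut n R) : discAut n (Polynomial R) := (exists_dilate ρ).choose

lemma dilate_X (ρ : discAut n R) (k : Fin n) :
    (dilate ρ).1 (MvPowerSeries.X k) = dilateSeries (ρ.1 (MvPowerSeries.X k)) :=
  (exists_dilate ρ).choose_spec k

lemma exists_scaling (n : ℕ) (u : Rˣ) : ∃ s : discAut n R,
    ∀ k, s.1 (MvPowerSeries.X k) = MvPowerSeries.C (u : R) * MvPowerSeries.X k := by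
  refine exists_discAut _ (fun k => by simp) ?_
  have e : linearPart (fun k => MvPowerSeries.C (u : R) * MvPowerSeries.X k) =
      Matrix.scalar (Fin n) (u : R) := by
    classical
    ext k j
    simp [linearPart_apply, MvPowerSeries.coeff_X, Matrix.diagonal_apply, Finsupp.single_left_inj,
      eq_comm]
  rw [e]
  simpa using u.isUnit.pow n

/-- The automorphism `t ↦ u t` of the formal disc, for a unit `u`. -/
def scaling (n : ℕ) (u : Rˣ) : discAut n R := (exists_scaling n u).choose

lemma scaling_X (u : Rˣ) (k : Fin n) :
    (scaling n u).1 (MvPowerSeries.X k) = MvPowerSeries.C (u : R) * MvPowerSeries.X k :=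
  (exists_scaling n u).choose_spec k

lemma scaling_apply (u : Rˣ) (f : MvPowerSeries (Fin n) R) :
    (scaling n u).1 f = MvPowerSeries.rescale (fun _ => (u : R)) f := by
  have h : (scaling n u).1.toAlgHom = MvPowerSeries.rescaleAlgHom (fun _ => (u : R)) :=
    algHom_ext_of_X (scaling n u).2 fun k => by
      refine (scaling_X u k).trans ?_
      rw [MvPowerSeries.rescaleAlgHom_apply]
      classical
      ext1 d
      rw [MvPowerSeries.coeff_rescale, prod_const_pow, MvPowerSeries.coeff_C_mul,
        MvPowerSeries.coeff_X]
      split_ifs with h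
      · subst h; simp
      · simp
  rw [← MvPowerSeries.rescaleAlgHom_apply, ← h]
  rfl

lemma discAutMap_scaling (f : R →+* R') (u : Rˣ) :
    discAutMap f (scaling n u) = scaling n (Units.map (f : R →* R') u) :=
  discAut_ext fun k => by
    rw [discAutMap_X, scaling_X, scaling_X, map_mul, MvPowerSeries.map_C, MvPowerSeries.map_X]
    rfl

/-- At an invertible parameter, the dilation is the conjugate by the scaling. -/
lemma discAutMap_dilate_mul_scaling (ρ : discAut n R) (g : Polynomial R →+* R') (u : R'ˣ)
    (hu : g Polynomial.X = u) :
    discAutMap g (dilate ρ) * scaling n u =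
      scaling n u * discAutMap (g.comp Polynomial.C) ρ := discAut_ext fun k => by
  change (discAutMap g (dilate ρ)).1 ((scaling n u).1 (MvPowerSeries.X k)) =
    (scaling n u).1 ((discAutMap (g.comp Polynomial.C) ρ).1 (MvPowerSeries.X k))
  have hC : (discAutMap g (dilate ρ)).1 (MvPowerSeries.C (u : R')) = MvPowerSeries.C (u : R') :=
    (discAutMap g (dilate ρ)).1.commutes _
  rw [scaling_X, map_mul, hC, discAutMap_X, dilate_X, discAutMap_X, scaling_apply, ← hu,
    ← MvPowerSeries.map_C, ← map_mul, C_X_mul_dilateSeries (ρ.2 k)]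
  ext1 d
  rw [MvPowerSeries.coeff_map, coeff_scaleHom, MvPowerSeries.coeff_rescale, prod_const_pow,
    MvPowerSeries.coeff_map, map_mul, map_pow]
  rfl

/-- At the parameter `λ = 1`, the dilation of `ρ` is `ρ`. -/
lemma discAutMap_dilate_of_one (ρ : discAut n R) (g : Polynomial R →+* R)
    (hC : ∀ r, g (Polynomial.C r) = r) (hX : g Polynomial.X = 1) :
    discAutMap g (dilate ρ) = ρ := discAut_ext fun k => by
  rw [discAutMap_X, dilate_X]
  ext1 d
  rw [MvPowerSeries.coeff_map, coeff_dilateSeries, ← Polynomial.C_mul_X_pow_eq_monomial, map_mul,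
    map_pow, hC, hX, one_pow, mul_one]

/-- If `ρ` is trivial up to order `c`, its dilation is trivial modulo `λ ^ c`. -/
lemma discAutMap_dilate_of_pow_eq_zero {ρ : discAut n R} {c : ℕ} (hρ : JetCongr c ρ 1)
    (g : Polynomial R →+* R') (hX : g Polynomial.X ^ c = 0) :
    discAutMap g (dilate ρ) = 1 := discAut_ext fun k => by
  classical
  rw [discAutMap_X, dilate_X]
  change _ = MvPowerSeries.X k
  ext1 d
  rw [MvPowerSeries.coeff_map, coeff_dilateSeries, ← Polynomial.C_mul_X_pow_eq_monomial, map_mul,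
    map_pow]
  by_cases hd : d.degree < c + 1
  · have h := mem_originIdeal_pow_iff.1 (hρ (MvPowerSeries.X k)) d hd
    rw [map_sub, sub_eq_zero] at h
    rw [h]
    change g (Polynomial.C (MvPowerSeries.coeff d (MvPowerSeries.X k))) * _ = _
    rw [MvPowerSeries.coeff_X, MvPowerSeries.coeff_X]
    split_ifs with h
    · subst h; simp
    · simp
  · have h1 : g Polynomial.X ^ (d.degree - 1) = 0 := pow_eq_zero_of_le (by omega) hX
    rw [h1, mul_zero, MvPowerSeries.coeff_X]
    split_ifs with hdk
    · -- a linear monomial forces `c = 0`, so that `R'` is the zero ring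
      subst hdk
      have hc : c = 0 := by simp at hd; omega
      subst hc
      rw [← hX, pow_zero]
    · rfl

end Dilation

/-! ### Étale coordinates and the Jacobian criterion -/

section EtaleChart

variable {n : ℕ} {R : Type u} [CommRing R]

/-- Elements `y₁, …, yₙ` of an `R`-algebra `B` are étale coordinates if the homomorphism
`R[t₁, …, tₙ] → B`, `t_k ↦ y_k`, is étale. -/
def IsEtaleChart (R : Type u) [CommRing R] {B : Type u} [CommRing B] [Algebra R B]
    (y : Fin n → B) : Prop :=
  (MvPolynomial.aeval y : MvPolynomial (Fin n) R →ₐ[R] B).toRingHom.Etale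

section Jacobian

open KaehlerDifferential

variable {A B : Type u} [CommRing A] [CommRing B] [Algebra R A] [Algebra R B] [Algebra A B]
  [IsScalarTower R A B]

lemma exists_basis_kaehlerDifferential [Algebra.FormallyEtale A B] {ι : Type*}
    (b : Module.Basis ι A Ω[A⁄R]) (x : ι → A) (hb : ∀ j, b j = D R A (x j)) :
    ∃ b' : Module.Basis ι B Ω[B⁄R], ∀ j, b' j = D R B (algebraMap A B (x j)) := by
  refine ⟨(b.baseChange B).map (tensorKaehlerEquivOfFormallyEtale R A B), fun j => ?_⟩
  rw [Module.Basis.map_apply, Module.Basis.baseChange_apply,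
    tensorKaehlerEquivOfFormallyEtale_apply, mapBaseChange_tmul, one_smul, hb, map_D]

/-- Jacobian criterion: an algebra homomorphism into a formally smooth algebra is étale if it
carries a basis of differentials to a basis of differentials. -/
lemma etale_of_isUnit_det [Algebra.FormallySmooth R B] [Algebra.FinitePresentation R B]
    [Algebra.FiniteType R A] {ι : Type*} [Fintype ι] [DecidableEq ι]
    (b : Module.Basis ι A Ω[A⁄R]) (b' : Module.Basis ι B Ω[B⁄R]) (M : Matrix ι ι B)
    (hM : IsUnit M.det) (h : ∀ k, map R R A B (b k) = ∑ j, M k j • b' j) :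
    Algebra.Etale A B := by
  have hmat : LinearMap.toMatrix (b.baseChange B) b' (mapBaseChange R A B) = M.transpose := by
    ext j k
    rw [LinearMap.toMatrix_apply, Module.Basis.baseChange_apply, mapBaseChange_tmul, one_smul, h,
      map_sum, Finsupp.finsetSum_apply, Matrix.transpose_apply, Finset.sum_eq_single j]
    · simp
    · intro i _ hij
      simp [hij]
    · simp
  have hbij : Function.Bijective (mapBaseChange R A B) := by
    have hu : IsUnit (LinearMap.toMatrix (b.baseChange B) b' (mapBaseChange R A B)).det := by
      rwa [hmat, Matrix.det_transpose]
    have e := LinearEquiv.coe_ofIsUnitDet hu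
    rw [← e]
    exact (LinearEquiv.ofIsUnitDet hu).bijective
  have h1 : Subsingleton Ω[B⁄A] := by
    refine subsingleton_of_forall_eq 0 fun w => ?_
    obtain ⟨v, rfl⟩ := map_surjective R A B w
    obtain ⟨x, rfl⟩ := hbij.2 v
    exact (exact_mapBaseChange_map R A B _).2 ⟨x, rfl⟩
  have h2 : Subsingleton (Algebra.H1Cotangent A B) := by
    refine subsingleton_of_forall_eq 0 fun w => ?_
    have hw : Algebra.H1Cotangent.δ R A B w = 0 := hbij.1 <| by
      rw [map_zero]
      exact (Algebra.H1Cotangent.exact_δ_mapBaseChange R A B _).2 ⟨w, rfl⟩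
    obtain ⟨v, rfl⟩ := (Algebra.H1Cotangent.exact_map_δ R A B w).1 hw
    rw [Subsingleton.elim v 0, map_zero]
  have h3 : Algebra.FormallyEtale A B := ⟨h1, h2⟩
  have h4 : Algebra.FinitePresentation A B :=
    Algebra.FinitePresentation.of_restrict_scalars_finitePresentation R A B
  exact ⟨h3, h4⟩

end Jacobian

variable {B : Type u} [CommRing B] [Algebra R B]

/-- The `R[t]`-algebra structure on `B` given by the tuple `y`. -/
abbrev chartAlgebra (R : Type u) [CommRing R] [Algebra R B] (y : Fin n → B) :
    Algebra (MvPolynomial (Fin n) R) B :=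
  (MvPolynomial.aeval y : MvPolynomial (Fin n) R →ₐ[R] B).toRingHom.toAlgebra

lemma chart_isScalarTower (y : Fin n → B) :
    letI := chartAlgebra R y
    IsScalarTower R (MvPolynomial (Fin n) R) B := by
  let _ := chartAlgebra R y
  exact IsScalarTower.of_algebraMap_eq fun r =>
    ((MvPolynomial.aeval y : MvPolynomial (Fin n) R →ₐ[R] B).commutes r).symm

lemma IsEtaleChart.exists_basis {y : Fin n → B} (hy : IsEtaleChart R y) :
    ∃ b : Module.Basis (Fin n) B Ω[B⁄R], ∀ j, b j = KaehlerDifferential.D R B (y j) := by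
  let _ := chartAlgebra R y
  have := chart_isScalarTower (R := R) y
  have : Algebra.Etale (MvPolynomial (Fin n) R) B := hy
  obtain ⟨b, hb⟩ := exists_basis_kaehlerDifferential (R := R) (B := B)
    (KaehlerDifferential.mvPolynomialBasis R (Fin n)) MvPolynomial.X (fun j => by simp)
  refine ⟨b, fun j => (hb j).trans (congrArg _ ?_)⟩
  exact MvPolynomial.aeval_X y j

lemma IsEtaleChart.smooth {y : Fin n → B} (hy : IsEtaleChart R y) : Algebra.Smooth R B := by
  let _ := chartAlgebra R y
  have := chart_isScalarTower (R := R) y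
  have : Algebra.Etale (MvPolynomial (Fin n) R) B := hy
  have : Algebra.Smooth R (MvPolynomial (Fin n) R) := ⟨inferInstance, inferInstance⟩
  exact Algebra.Smooth.comp R (MvPolynomial (Fin n) R) B

lemma IsEtaleChart.of_isUnit_det {y z : Fin n → B} (hy : IsEtaleChart R y)
    (M : Matrix (Fin n) (Fin n) B) (hM : IsUnit M.det)
    (h : ∀ k, KaehlerDifferential.D R B (z k) = ∑ j, M k j • KaehlerDifferential.D R B (y j)) :
    IsEtaleChart R z := by
  classical
  obtain ⟨b, hb⟩ := hy.exists_basis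
  have := hy.smooth
  let _ := chartAlgebra R z
  have := chart_isScalarTower (R := R) z
  refine etale_of_isUnit_det (R := R) (KaehlerDifferential.mvPolynomialBasis R (Fin n)) b M hM
    fun k => ?_
  have e : algebraMap (MvPolynomial (Fin n) R) B (MvPolynomial.X k) = z k :=
    MvPolynomial.aeval_X z k
  simp only [hb, KaehlerDifferential.mvPolynomialBasis_apply, KaehlerDifferential.map_D, e, h]

lemma IsEtaleChart.localization {y : Fin n → B} (hy : IsEtaleChart R y) (r : B) :
    IsEtaleChart R fun k => algebraMap B (Localization.Away r) (y k) := by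
  have h2 : (algebraMap B (Localization.Away r)).Etale :=
    RingHom.etale_algebraMap.2 (Algebra.Etale.of_isLocalizationAway r)
  have h3 := RingHom.Etale.stableUnderComposition _ _ hy h2
  refine Eq.subst (motive := fun g : MvPolynomial (Fin n) R →+* Localization.Away r => g.Etale) ?_ h3
  refine MvPolynomial.ringHom_ext (fun r => ?_) fun k => ?_
  · simp [IsScalarTower.algebraMap_apply R B (Localization.Away _)]
  · simp

lemma isEtaleChart_X : IsEtaleChart R (MvPolynomial.X : Fin n → MvPolynomial (Fin n) R) := by
  rw [IsEtaleChart, MvPolynomial.aeval_X_left]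
  exact RingHom.Etale.of_bijective Function.bijective_id

end EtaleChart

/-! ### Étale automorphisms from étale coordinates -/

section Realizes

variable {n : ℕ} {R : Type u} [CommRing R]

lemma jetEval_toJet (c : ℕ) (f : MvPowerSeries (Fin n) R) :
    jetEval n R c (toJet n R c f) = MvPowerSeries.constantCoeff f := rfl

lemma algebraMap_jetRing (c : ℕ) (r : R) :
    algebraMap R (JetRing n R c) r = toJet n R c (MvPowerSeries.C r) := rfl

lemma isUnit_of_jetEval {c : ℕ} {x : JetRing n R c} (h : IsUnit (jetEval n R c x)) : IsUnit x := by
  obtain ⟨f, rfl⟩ := Ideal.Quotient.mk_surjective x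
  exact (MvPowerSeries.isUnit_iff_constantCoeff.2 h).map _

variable {B : Type u} [CommRing B] [Algebra R B]

/-- The `R`-algebra `B` with augmentation `τ` and étale coordinates `y`, together with the functions
`z`, induces the automorphism `ρ`: expanded as power series in `y` along the section `τ`, the
functions `z` become `ρ(t₁), …, ρ(tₙ)`. The expansions are given as homomorphisms to the rings of
jets. -/
def Realizes (τ : B →ₐ[R] R) (y z : Fin n → B) (ρ : discAut n R) : Prop :=
  ∀ c, ∃ ℓ : B →ₐ[R] JetRing n R c, (∀ b, jetEval n R c (ℓ b) = τ b) ∧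
    (∀ k, ℓ (y k) = toJet n R c (MvPowerSeries.X k)) ∧
    ∀ k, ℓ (z k) = toJet n R c (ρ.1 (MvPowerSeries.X k))

lemma Realizes.apply_coord {τ : B →ₐ[R] R} {y z : Fin n → B} {ρ : discAut n R}
    (h : Realizes τ y z ρ) (k : Fin n) : τ (y k) = 0 := by
  obtain ⟨ℓ, h1, h2, -⟩ := h 0
  rw [← h1, h2, jetEval_toJet, MvPowerSeries.constantCoeff_X]

lemma Realizes.apply_fun {τ : B →ₐ[R] R} {y z : Fin n → B} {ρ : discAut n R}
    (h : Realizes τ y z ρ) (k : Fin n) : τ (z k) = 0 := by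
  obtain ⟨ℓ, h1, -, h3⟩ := h 0
  rw [← h1, h3, jetEval_toJet]
  exact ρ.2 k

lemma Realizes.localization {τ : B →ₐ[R] R} {y z : Fin n → B} {ρ : discAut n R}
    (h : Realizes τ y z ρ) {r : B} (hr : IsUnit (τ r)) :
    ∃ τ' : Localization.Away r →ₐ[R] R, (∀ b, τ' (algebraMap B _ b) = τ b) ∧
      Realizes τ' (fun k => algebraMap B _ (y k)) (fun k => algebraMap B _ (z k)) ρ := by
  have ext : ∀ {S : Type u} [CommRing S] [Algebra R S] (g : B →ₐ[R] S), IsUnit (g r) →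
      ∃ g' : Localization.Away r →ₐ[R] S, ∀ b, g' (algebraMap B _ b) = g b := by
    intro S _ _ g hg
    have hg' : ∀ s : Submonoid.powers r, IsUnit (g s) := by
      rintro ⟨_, m, rfl⟩
      rw [map_pow]
      exact hg.pow m
    exact ⟨IsLocalization.liftAlgHom (M := Submonoid.powers r) hg', fun b => by simp⟩
  obtain ⟨τ', hτ'⟩ := ext τ hr
  refine ⟨τ', hτ', fun c => ?_⟩
  obtain ⟨ℓ, h1, h2, h3⟩ := h c
  obtain ⟨ℓ', hℓ'⟩ := ext ℓ (isUnit_of_jetEval (by rwa [h1]))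
  refine ⟨ℓ', fun b => ?_, fun k => by rw [hℓ', h2], fun k => by rw [hℓ', h3]⟩
  have e : ((jetEval n R c).comp (ℓ' : Localization.Away r →+* JetRing n R c)) =
      (τ' : Localization.Away r →+* R) := by
    refine IsLocalization.ringHom_ext (Submonoid.powers r) (RingHom.ext fun b => ?_)
    change jetEval n R c (ℓ' (algebraMap B _ b)) = τ' (algebraMap B _ b)
    rw [hℓ', hτ', h1]
  exact DFunLike.congr_fun e b

/-- If `y` and `z` both are étale coordinates, `Spec B` is a common étale neighbourhood. -/
lemma Realizes.mem_etaleAut {τ : B →ₐ[R] R} {y z : Fin n → B} {ρ : discAut n R}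
    (h : Realizes τ y z ρ) (hy : IsEtaleChart R y) (hz : IsEtaleChart R z) : ρ ∈ etaleAut n R := by
  have hτ : ∀ w : Fin n → B, (∀ k, τ (w k) = 0) →
      (τ : B →+* R).comp (MvPolynomial.aeval w : MvPolynomial (Fin n) R →ₐ[R] B).toRingHom =
        MvPolynomial.constantCoeff := fun w hw => by
    refine MvPolynomial.ringHom_ext (fun r => ?_) fun k => ?_
    · simp
    · simp [hw]
  have hC : ∀ w : Fin n → B,
      (MvPolynomial.aeval w : MvPolynomial (Fin n) R →ₐ[R] B).toRingHom.comp MvPolynomial.C =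
        algebraMap R B := fun w => RingHom.ext fun r => by simp
  let E : StrictEtaleNbhd n R :=
    { V := Spec (CommRingCat.of B)
      π := specMap (algebraMap R B)
      τ := specMap (τ : B →+* R)
      φ := specMap (MvPolynomial.aeval z : MvPolynomial (Fin n) R →ₐ[R] B).toRingHom
      ψ := specMap (MvPolynomial.aeval y : MvPolynomial (Fin n) R →ₐ[R] B).toRingHom
      etale_φ := (HasRingHomProperty.Spec_iff (P := @Etale)).2 hz
      etale_ψ := (HasRingHomProperty.Spec_iff (P := @Etale)).2 hy
      τ_π := by
        rw [specMap_comp, AlgHom.comp_algebraMap]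
        exact Spec.map_id _
      φ_proj := by rw [specMap_comp, hC]
      ψ_proj := by rw [specMap_comp, hC]
      τ_φ := by rw [specMap_comp, hτ z h.apply_fun]
      τ_ψ := by rw [specMap_comp, hτ y h.apply_coord] }
  refine ⟨E, fun c => ?_⟩
  obtain ⟨ℓ, h1, h2, h3⟩ := h c
  refine ⟨specMap (ℓ : B →+* JetRing n R c), ?_, ?_, ?_⟩
  · rw [specMap_comp]
    exact congrArg specMap (RingHom.ext h1)
  · rw [specMap_comp]
    refine congrArg specMap (MvPolynomial.ringHom_ext (fun r => ?_) fun k => ?_)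
    · simp [algebraMap_jetRing]
    · simpa using h2 k
  · rw [specMap_comp]
    refine congrArg specMap (MvPolynomial.ringHom_ext (fun r => ?_) fun k => ?_)
    · have e : ρ.1 (MvPowerSeries.C r) = MvPowerSeries.C r := ρ.1.commutes r
      simp [e, algebraMap_jetRing]
    · simpa using h3 k

/-- If `z` is a combination of étale coordinates, it is étale near the section: there the Jacobian of
`z` is the linear part of the automorphism. -/
lemma Realizes.mem_etaleAut_of_sum {τ : B →ₐ[R] R} {y : Fin n → B} {h : Matrix (Fin n) (Fin n) B}
    {ρ : discAut n R} (H : Realizes τ y (fun k => ∑ j, h k j * y j) ρ) (hy : IsEtaleChart R y) :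
    ρ ∈ etaleAut n R := by
  classical
  obtain ⟨b, hb⟩ := hy.exists_basis
  let M : Matrix (Fin n) (Fin n) B := fun k i =>
    h k i + ∑ j, y j * b.repr (KaehlerDifferential.D R B (h k j)) i
  have hM : ∀ k, KaehlerDifferential.D R B (∑ j, h k j * y j) =
      ∑ j, M k j • KaehlerDifferential.D R B (y j) := fun k => by
    have e : ∀ w : Ω[B⁄R], w = ∑ i, b.repr w i • KaehlerDifferential.D R B (y i) := fun w => by
      simp only [← hb, b.sum_repr]
    simp only [map_sum, Derivation.leibniz, Finset.sum_add_distrib, M, add_smul, Finset.sum_smul]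
    congr 1
    rw [Finset.sum_comm]
    refine Finset.sum_congr rfl fun j _ => ?_
    conv_lhs => rw [e (KaehlerDifferential.D R B (h k j))]
    rw [Finset.smul_sum]
    simp only [mul_smul]
  have hτM : M.map τ = h.map τ := by
    ext k i
    change τ (h k i + ∑ j, y j * b.repr (KaehlerDifferential.D R B (h k j)) i) = τ (h k i)
    simp [H.apply_coord]
  have hlin : h.map τ = linearPart fun k => ρ.1 (MvPowerSeries.X k) := by
    obtain ⟨ℓ, h1, h2, h3⟩ := H 1
    choose g hg using fun k j => Ideal.Quotient.mk_surjective (ℓ (h k j))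
    have e1 : ∀ k, toJet n R 1 (∑ j, g k j * MvPowerSeries.X j) =
        toJet n R 1 (ρ.1 (MvPowerSeries.X k)) := fun k => by
      rw [← h3, map_sum, map_sum]
      exact Finset.sum_congr rfl fun j _ => by rw [map_mul, map_mul, h2, ← hg]
    have e2 : (linearPart fun k => ρ.1 (MvPowerSeries.X k)) =
        linearPart fun k => ∑ j, g k j * MvPowerSeries.X j := by
      ext k j
      have := mem_originIdeal_pow_iff.1 (Ideal.Quotient.eq.1 (e1 k)) (Finsupp.single j 1) (by simp)
      rw [map_sub, sub_eq_zero] at this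
      exact this.symm
    rw [e2, linearPart_sum_mul _ _ (by simp), linearPart_X, mul_one]
    ext k j
    rw [Matrix.map_apply, ← h1, ← hg]
    rfl
  have hJ : IsUnit (τ M.det) := by
    have e : τ M.det = (M.map τ).det := τ.map_det M
    rw [e, hτM, hlin]
    exact isUnit_det_linearPart ρ
  obtain ⟨τ', -, hR⟩ := H.localization hJ
  have hy' := hy.localization M.det
  refine hR.mem_etaleAut hy' (hy'.of_isUnit_det (M.map (algebraMap B _)) ?_ fun k => ?_)
  · rw [← RingHom.mapMatrix_apply, ← RingHom.map_det]
    exact IsLocalization.Away.algebraMap_isUnit _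
  · rw [← KaehlerDifferential.map_D R R, hM, map_sum]
    refine Finset.sum_congr rfl fun j _ => ?_
    rw [map_smul, KaehlerDifferential.map_D, Matrix.map_apply, algebraMap_smul]

/-- Automorphisms given by polynomials are étale. -/
lemma mem_etaleAut_of_polynomial {ρ : discAut n R} (p : Fin n → MvPolynomial (Fin n) R)
    (hp : ∀ k, ρ.1 (MvPowerSeries.X k) = (p k : MvPowerSeries (Fin n) R)) : ρ ∈ etaleAut n R := by
  have h0 : ∀ k, p k ∈ Ideal.span (Set.range (MvPolynomial.X : Fin n → MvPolynomial (Fin n) R)) :=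
    fun k => by
      have h : MvPowerSeries.constantCoeff (ρ.1 (MvPowerSeries.X k)) = 0 := ρ.2 k
      rw [hp, ← MvPowerSeries.coeff_zero_eq_constantCoeff_apply, MvPolynomial.coeff_coe] at h
      have := MvPolynomial.mem_pow_idealOfVars_iff' 1 (p k)
      rw [pow_one] at this
      refine this.2 fun d hd => ?_
      rwa [(Finsupp.degree_eq_zero_iff d).1 (by simpa using hd)]
  choose h hh using fun k => Ideal.mem_span_range_iff_exists_fun.1 (h0 k)
  refine Realizes.mem_etaleAut_of_sum (B := MvPolynomial (Fin n) R)
    (τ := MvPolynomial.aeval fun _ => 0) (y := MvPolynomial.X) (h := h) (fun c => ?_) isEtaleChart_X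
  refine ⟨⟨(toJet n R c).comp (polyToSeries n R), fun r => ?_⟩, fun b => ?_, fun k => ?_, fun k => ?_⟩
  · simp [algebraMap_jetRing, MvPolynomial.algebraMap_eq]
  · change MvPowerSeries.constantCoeff (b : MvPowerSeries (Fin n) R) = _
    rw [← MvPowerSeries.coeff_zero_eq_constantCoeff_apply, MvPolynomial.coeff_coe,
      ← MvPolynomial.constantCoeff_eq]
    simp
  · change toJet n R c (polyToSeries n R (MvPolynomial.X k)) = _
    simp
  · rw [hp]
    exact congrArg (fun q => toJet n R c (polyToSeries n R q)) (hh k)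

/-- Every automorphism of the formal disc agrees with an étale one up to any given order: truncate
the power series. -/
lemma exists_etaleAut_jetCongr (ρ : discAut n R) (c : ℕ) :
    ∃ σ ∈ etaleAut n R, JetCongr c σ ρ := by
  let p : Fin n → MvPolynomial (Fin n) R := fun k =>
    MvPowerSeries.truncTotal (c + 2) (ρ.1 (MvPowerSeries.X k))
  have hp : ∀ k (d : Fin n →₀ ℕ), d.degree < c + 2 →
      MvPowerSeries.coeff d (p k : MvPowerSeries (Fin n) R) =
        MvPowerSeries.coeff d (ρ.1 (MvPowerSeries.X k)) := fun k d hd => by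
    rw [MvPolynomial.coeff_coe, MvPowerSeries.coeff_truncTotal _ hd]
  obtain ⟨σ, hσ⟩ := exists_discAut (fun k => (p k : MvPowerSeries (Fin n) R))
    (fun k => by
      rw [← MvPowerSeries.coeff_zero_eq_constantCoeff_apply, hp _ _ (by simp),
        MvPowerSeries.coeff_zero_eq_constantCoeff_apply]
      exact ρ.2 k)
    (by
      have e : linearPart (fun k => (p k : MvPowerSeries (Fin n) R)) =
          linearPart fun k => ρ.1 (MvPowerSeries.X k) := by
        ext k j
        exact hp k _ (by simp)
      rw [e]
      exact isUnit_det_linearPart ρ)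
  refine ⟨σ, mem_etaleAut_of_polynomial p hσ, jetCongr_of_X fun k => ?_⟩
  refine mem_originIdeal_pow_iff.2 fun d hd => ?_
  rw [map_sub, hσ, hp k d (by omega), sub_self]

lemma scaling_mem_etaleAut (u : Rˣ) : scaling n u ∈ etaleAut n R :=
  mem_etaleAut_of_polynomial (fun k => MvPolynomial.C (u : R) * MvPolynomial.X k) fun k => by
    rw [scaling_X]; simp

end Realizes

/-! ### Dilation in étale coordinates -/

section DilationEtale

variable {n : ℕ} {R R' : Type u} [CommRing R] [CommRing R']

/-- Near the section, étale coordinates generate the ideal of the section: by unramifiedness the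
ideal `I` of the section satisfies `I = I² + (y)`. -/
lemma IsEtaleChart.exists_smul_ker_le {B : Type u} [CommRing B] [Algebra R B] {y : Fin n → B}
    (hy : IsEtaleChart R y) (τ : B →ₐ[R] R) (hτ : ∀ k, τ (y k) = 0) :
    ∃ r : B, τ r = 1 ∧ ∀ b, τ b = 0 → ∃ h : Fin n → B, r * b = ∑ j, h j * y j := by
  let _ := chartAlgebra R y
  have := chart_isScalarTower (R := R) y
  have : Algebra.Etale (MvPolynomial (Fin n) R) B := hy
  have := hy.smooth
  let I : Ideal B := RingHom.ker τ
  let N : Ideal B := Ideal.span (Set.range y)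
  have hNI : N ≤ I := by
    rw [Ideal.span_le]
    rintro _ ⟨k, rfl⟩
    exact hτ k
  let Q := B ⧸ (I ^ 2 ⊔ N)
  have hIle : I ≤ N ⊔ I • I := by
    -- the identity and the retraction onto the section agree modulo the square-zero ideal `I`
    let g₁ : B →ₐ[MvPolynomial (Fin n) R] Q :=
      IsScalarTower.toAlgHom (MvPolynomial (Fin n) R) B Q
    let q : B →+* Q :=
      ((Ideal.Quotient.mk (I ^ 2 ⊔ N)).comp (algebraMap R B)).comp (τ : B →+* R)
    have hq : q.comp (algebraMap (MvPolynomial (Fin n) R) B) =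
        algebraMap (MvPolynomial (Fin n) R) Q := by
      refine MvPolynomial.ringHom_ext (fun r => ?_) fun k => ?_
      · change Ideal.Quotient.mk _ (algebraMap R B (τ (MvPolynomial.aeval y (MvPolynomial.C r)))) =
          Ideal.Quotient.mk _ (MvPolynomial.aeval y (MvPolynomial.C r))
        simp
      · change Ideal.Quotient.mk _ (algebraMap R B (τ (MvPolynomial.aeval y (MvPolynomial.X k)))) =
          Ideal.Quotient.mk _ (MvPolynomial.aeval y (MvPolynomial.X k))
        rw [MvPolynomial.aeval_X, hτ, map_zero, map_zero, eq_comm, Ideal.Quotient.eq_zero_iff_mem]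
        exact Ideal.mem_sup_right (Ideal.subset_span ⟨k, rfl⟩)
    let g₂ : B →ₐ[MvPolynomial (Fin n) R] Q :=
      { toRingHom := q, commutes' := DFunLike.congr_fun hq }
    have hnil : IsNilpotent (I.map (Ideal.Quotient.mk (I ^ 2 ⊔ N))) := by
      refine ⟨2, ?_⟩
      rw [← Ideal.map_pow, Ideal.zero_eq_bot, Ideal.map_eq_bot_iff_le_ker, Ideal.mk_ker]
      exact le_sup_left
    have h12 : g₁ = g₂ := Algebra.FormallyUnramified.ext _ hnil fun b => by
      refine Ideal.Quotient.eq.2 ?_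
      change Ideal.Quotient.mk (I ^ 2 ⊔ N) b - Ideal.Quotient.mk (I ^ 2 ⊔ N) (algebraMap R B (τ b)) ∈ _
      rw [← map_sub]
      refine Ideal.mem_map_of_mem _ ?_
      change τ (b - algebraMap R B (τ b)) = 0
      simp
    intro b hb
    have h := DFunLike.congr_fun h12 b
    change Ideal.Quotient.mk (I ^ 2 ⊔ N) b = Ideal.Quotient.mk (I ^ 2 ⊔ N) (algebraMap R B (τ b)) at h
    rw [show τ b = 0 from hb, map_zero, map_zero, Ideal.Quotient.eq_zero_iff_mem] at h
    rwa [sup_comm, smul_eq_mul, ← pow_two]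
  have hfg : I.FG := Algebra.FinitePresentation.ker_fG_of_surjective τ fun r =>
    ⟨algebraMap R B r, by simp⟩
  obtain ⟨r, hr1, hr2⟩ := Submodule.exists_sub_one_mem_and_smul_le_of_fg_of_le_sup hfg le_rfl hIle
  refine ⟨r, ?_, fun b hb => ?_⟩
  · have : τ (r - 1) = 0 := hr1
    rwa [map_sub, map_one, sub_eq_zero] at this
  · have h : r * b ∈ N := hr2 (Submodule.smul_mem_pointwise_smul b r I hb)
    obtain ⟨h, hh⟩ := Ideal.mem_span_range_iff_exists_fun.1 h
    exact ⟨h, hh.symm⟩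

/-- Base change of étale coordinates along `R[t] → R'[t]`, `t_k ↦ r t_k`. -/
lemma IsEtaleChart.exists_baseChange {B : Type u} [CommRing B] [Algebra R B] {y : Fin n → B}
    (hy : IsEtaleChart R y) (f : R →+* R') (r : R') (τ : B →+* R')
    (m : ∀ c, B →+* JetRing n R' c) (hmτ : ∀ c b, jetEval n R' c (m c b) = τ b)
    (hm : ∀ c s, m c (algebraMap R B s) = algebraMap R' _ (f s))
    (hmy : ∀ c k, m c (y k) = toJet n R' c (MvPowerSeries.C r * MvPowerSeries.X k)) :
    ∃ (C : Type u) (_ : CommRing C) (_ : Algebra R' C) (x : Fin n → C) (j : B →+* C)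
      (τ' : C →ₐ[R'] R'), IsEtaleChart R' x ∧ (∀ k, j (y k) = algebraMap R' C r * x k) ∧
      ∀ c, ∃ ℓ : C →ₐ[R'] JetRing n R' c, (∀ b, jetEval n R' c (ℓ b) = τ' b) ∧
        (∀ k, ℓ (x k) = toJet n R' c (MvPowerSeries.X k)) ∧ ∀ b, ℓ (j b) = m c b := by
  let _ := chartAlgebra R y
  have : Algebra.Etale (MvPolynomial (Fin n) R) B := hy
  let θ : MvPolynomial (Fin n) R →+* MvPolynomial (Fin n) R' :=
    MvPolynomial.eval₂Hom (MvPolynomial.C.comp f) fun k => MvPolynomial.C r * MvPolynomial.X k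
  let _ : Algebra (MvPolynomial (Fin n) R) (MvPolynomial (Fin n) R') := θ.toAlgebra
  let C := MvPolynomial (Fin n) R' ⊗[MvPolynomial (Fin n) R] B
  let il : MvPolynomial (Fin n) R' →+* C :=
    (Algebra.TensorProduct.includeLeft : _ →ₐ[MvPolynomial (Fin n) R'] C).toRingHom
  let ir : B →+* C :=
    (Algebra.TensorProduct.includeRight : B →ₐ[MvPolynomial (Fin n) R] C).toRingHom
  have hilr : il.comp θ = ir.comp (algebraMap (MvPolynomial (Fin n) R) B) := by
    refine RingHom.ext fun p => ?_
    change (θ p) ⊗ₜ[MvPolynomial (Fin n) R] (1 : B) = 1 ⊗ₜ (algebraMap _ B p)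
    rw [Algebra.algebraMap_eq_smul_one, ← TensorProduct.smul_tmul, Algebra.smul_def, mul_one]
    rfl
  let algC : Algebra R' C := (il.comp MvPolynomial.C).toAlgebra
  have hil : (MvPolynomial.aeval (fun k => il (MvPolynomial.X k)) :
      MvPolynomial (Fin n) R' →ₐ[R'] C).toRingHom = il := by
    refine MvPolynomial.ringHom_ext (fun s => ?_) fun k => ?_
    · change MvPolynomial.aeval _ (MvPolynomial.C s) = _
      rw [MvPolynomial.aeval_C]
      rfl
    · change MvPolynomial.aeval _ (MvPolynomial.X k) = _
      rw [MvPolynomial.aeval_X]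
  -- homomorphisms out of `C`
  have ext : ∀ {S : Type u} [CommRing S] (a : MvPolynomial (Fin n) R' →+* S) (b : B →+* S),
      a.comp θ = b.comp (algebraMap (MvPolynomial (Fin n) R) B) →
      ∃ g : C →+* S, g.comp il = a ∧ g.comp ir = b := by
    intro S _ a b hab
    let _ : Algebra (MvPolynomial (Fin n) R) S := (a.comp θ).toAlgebra
    let a' : MvPolynomial (Fin n) R' →ₐ[MvPolynomial (Fin n) R] S :=
      { toRingHom := a, commutes' := fun _ => rfl }
    let b' : B →ₐ[MvPolynomial (Fin n) R] S :=
      { toRingHom := b, commutes' := fun p => (DFunLike.congr_fun hab p).symm }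
    let l : C →ₐ[MvPolynomial (Fin n) R] S :=
      Algebra.TensorProduct.lift a' b' fun _ _ => Commute.all _ _
    refine ⟨l.toRingHom, RingHom.ext fun p => ?_, RingHom.ext fun p => ?_⟩
    · exact (Algebra.TensorProduct.lift_tmul a' b' (fun _ _ => Commute.all _ _) p 1).trans
        (by rw [map_one, mul_one]; rfl)
    · exact (Algebra.TensorProduct.lift_tmul a' b' (fun _ _ => Commute.all _ _) 1 p).trans
        (by rw [map_one, one_mul]; rfl)
  have hg : ∀ c, ∃ g : C →+* JetRing n R' c,
      g.comp il = (toJet n R' c).comp (polyToSeries n R') ∧ g.comp ir = m c := fun c => by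
    refine ext _ _ (MvPolynomial.ringHom_ext (fun s => ?_) fun k => ?_)
    · change toJet n R' c (polyToSeries n R' (θ (MvPolynomial.C s))) =
        m c (MvPolynomial.aeval y (MvPolynomial.C s))
      rw [MvPolynomial.aeval_C, hm, algebraMap_jetRing]
      simp [θ]
    · change toJet n R' c (polyToSeries n R' (θ (MvPolynomial.X k))) =
        m c (MvPolynomial.aeval y (MvPolynomial.X k))
      rw [MvPolynomial.aeval_X, hmy]
      simp [θ]
  choose g hg1 hg2 using hg
  let ℓ : ∀ c, C →ₐ[R'] JetRing n R' c := fun c =>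
    { toRingHom := g c
      commutes' := fun s => by
        refine (DFunLike.congr_fun (hg1 c) (MvPolynomial.C s)).trans ?_
        simp [algebraMap_jetRing] }
  let τ' : C →ₐ[R'] R' :=
    { toRingHom := (jetEval n R' 0).comp (g 0)
      commutes' := fun s => by
        change jetEval n R' 0 (g 0 (il (MvPolynomial.C s))) = s
        have := DFunLike.congr_fun (hg1 0) (MvPolynomial.C s)
        change g 0 (il (MvPolynomial.C s)) = _ at this
        rw [this]
        simp [jetEval_toJet] }
  refine ⟨C, inferInstance, algC, fun k => il (MvPolynomial.X k), ir, τ', ?_, fun k => ?_,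
    fun c => ⟨ℓ c, fun b => ?_, fun k => ?_, DFunLike.congr_fun (hg2 c)⟩⟩
  · rw [IsEtaleChart, hil]
    have : Algebra.Etale (MvPolynomial (Fin n) R') C := inferInstance
    exact RingHom.etale_algebraMap.2 this
  · have := DFunLike.congr_fun hilr (MvPolynomial.X k)
    change il (θ (MvPolynomial.X k)) = ir (MvPolynomial.aeval y (MvPolynomial.X k)) at this
    rw [MvPolynomial.aeval_X] at this
    rw [← this]
    simp only [θ, MvPolynomial.eval₂Hom_X', map_mul]
    rfl
  · have e : (jetEval n R' c).comp (g c) = (jetEval n R' 0).comp (g 0) := by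
      have h1 : ∀ c, ((jetEval n R' c).comp (g c)).comp il = MvPolynomial.constantCoeff := fun c => by
        rw [RingHom.comp_assoc, hg1]
        refine MvPolynomial.ringHom_ext (fun s => ?_) fun k => ?_
        · simp [jetEval_toJet]
        · simp [jetEval_toJet]
      have h2 : ∀ c, ((jetEval n R' c).comp (g c)).comp ir = τ := fun c => by
        rw [RingHom.comp_assoc, hg2]
        exact RingHom.ext (hmτ c)
      refine RingHom.ext fun w => ?_
      induction w using TensorProduct.induction_on with
      | zero => simp
      | add a b ha hb => rw [map_add, map_add, ha, hb]
      | tmul p b =>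
        have : p ⊗ₜ[MvPolynomial (Fin n) R] b = il p * ir b := by
          change _ = (p ⊗ₜ 1) * (1 ⊗ₜ b)
          rw [Algebra.TensorProduct.tmul_mul_tmul, one_mul, mul_one]
        rw [this, map_mul, map_mul]
        have e1 := fun c => DFunLike.congr_fun (h1 c) p
        have e2 := fun c => DFunLike.congr_fun (h2 c) b
        exact congrArg₂ (· * ·) ((e1 c).trans (e1 0).symm) ((e2 c).trans (e2 0).symm)
    exact DFunLike.congr_fun e b
  · refine (DFunLike.congr_fun (hg1 c) (MvPolynomial.X k)).trans ?_
    simp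

/-- The map of jet rings induced by `t ↦ λ t`. -/
def jetScale (n : ℕ) (R : Type u) [CommRing R] (c : ℕ) :
    JetRing n R c →+* JetRing n (Polynomial R) c :=
  Ideal.quotientMap _ (scaleHom n R)
    (originIdeal_pow_le_comap _ (fun k => by rw [scaleHom_X]; simp) _)

lemma jetScale_toJet (c : ℕ) (f : MvPowerSeries (Fin n) R) :
    jetScale n R c (toJet n R c f) = toJet n (Polynomial R) c (scaleHom n R f) := rfl

/-- The dilation of an automorphism realized by étale coordinates is étale: pull the étale
coordinates `y` back along `t ↦ λ t`, so that `y = λ x`. If `z = ∑ h y` near the section, the dilation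
is realized by `∑ h x`. -/
theorem Realizes.dilate_mem_etaleAut {B : Type u} [CommRing B] [Algebra R B] {τ : B →ₐ[R] R}
    {y z : Fin n → B} {ρ : discAut n R} (H : Realizes τ y z ρ) (hy : IsEtaleChart R y) :
    dilate ρ ∈ etaleAut n (Polynomial R) := by
  obtain ⟨r, hr, hI⟩ := hy.exists_smul_ker_le τ H.apply_coord
  choose h hh using fun k => hI _ (H.apply_fun k)
  obtain ⟨τ', -, H'⟩ := H.localization (r := r) (by rw [hr]; exact isUnit_one)
  let B' := Localization.Away r
  have hy' := hy.localization r
  obtain ⟨s, hs⟩ : ∃ s : B', s * algebraMap B B' r = 1 :=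
    (IsLocalization.Away.algebraMap_isUnit (S := B') r).exists_left_inv
  have hz : ∀ k, algebraMap B B' (z k) =
      ∑ j, (s * algebraMap B B' (h k j)) * algebraMap B B' (y j) := fun k => by
    have := congrArg (fun b => s * algebraMap B B' b) (hh k)
    simp only [map_mul, ← mul_assoc, hs, one_mul, map_sum, Finset.mul_sum] at this
    exact this
  choose ℓ h1 h2 h3 using H'
  obtain ⟨C, _, _, x, j, τC, hx, hjx, hC⟩ := hy'.exists_baseChange Polynomial.C Polynomial.X
    (Polynomial.C.comp (τ' : B' →+* R))
    (fun c => (jetScale n R c).comp (ℓ c : B' →+* JetRing n R c))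
    (fun c b => by
      obtain ⟨f, hf⟩ := Ideal.Quotient.mk_surjective (ℓ c b)
      change jetEval n _ c (jetScale n R c (ℓ c b)) = Polynomial.C (τ' b)
      rw [← h1 c, ← hf, jetScale_toJet, jetEval_toJet, jetEval_toJet,
        ← MvPowerSeries.coeff_zero_eq_constantCoeff_apply, coeff_scaleHom]
      simp)
    (fun c a => by
      change jetScale n R c (ℓ c (algebraMap R B' a)) = _
      rw [AlgHom.commutes, algebraMap_jetRing, jetScale_toJet, scaleHom_C, algebraMap_jetRing])
    (fun c k => by
      change jetScale n R c (ℓ c _) = _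
      rw [h2, jetScale_toJet, scaleHom_X])
  refine Realizes.mem_etaleAut_of_sum (τ := τC) (y := x)
    (h := Matrix.of fun k i => j (s * algebraMap B B' (h k i))) (fun c => ?_) hx
  obtain ⟨m, m1, m2, m3⟩ := hC c
  refine ⟨m, m1, m2, fun k => ?_⟩
  obtain ⟨F, hF⟩ := Ideal.Quotient.mk_surjective (m (∑ i, j (s * algebraMap B B' (h k i)) * x i))
  refine hF.symm.trans (Ideal.Quotient.eq.2 ?_)
  -- compare after multiplication by `λ`
  have key : MvPowerSeries.C Polynomial.X * F - scaleHom n R (ρ.1 (MvPowerSeries.X k)) ∈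
      originIdeal n (Polynomial R) ^ (c + 1) := by
    refine Ideal.Quotient.eq.1 ?_
    rw [map_mul, hF]
    have e : algebraMap (Polynomial R) C Polynomial.X *
        (∑ i, j (s * algebraMap B B' (h k i)) * x i) = j (algebraMap B B' (z k)) := by
      rw [hz, map_sum, Finset.mul_sum]
      refine Finset.sum_congr rfl fun i _ => ?_
      rw [map_mul j (s * _), hjx]
      ring
    have e2 := congrArg m e
    rw [map_mul, AlgHom.commutes, m3] at e2
    refine e2.trans ?_
    change jetScale n R c (ℓ c _) = _
    rw [h3, jetScale_toJet]
  rw [← C_X_mul_dilateSeries (ρ.2 k), ← mul_sub, ← dilate_X] at key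
  refine mem_originIdeal_pow_iff.2 fun d hd => ?_
  have := mem_originIdeal_pow_iff.1 key d hd
  rw [MvPowerSeries.coeff_C_mul] at this
  exact Polynomial.isRegular_X.left.eq_iff.1 (this.trans (mul_zero _).symm)

end DilationEtale

/-! ### Dilation of étale automorphisms, locally on the base -/

section Localize

variable {n : ℕ} {R : Type u} [CommRing R]

lemma specMap_injective {A B : Type u} [CommRing A] [CommRing B] {f g : A →+* B}
    (h : specMap f = specMap g) : f = g :=
  congrArg CommRingCat.Hom.hom (Spec.map_injective h)

lemma specMap_jetEval_surjective (c : ℕ) : Function.Surjective (specMap (jetEval n R c)) := by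
  have hs : Function.Surjective (jetEval n R c) := fun r =>
    ⟨toJet n R c (MvPowerSeries.C r), by rw [jetEval_toJet, MvPowerSeries.constantCoeff_C]⟩
  intro x
  have hx : x ∈ Set.range (PrimeSpectrum.comap (jetEval n R c)) := by
    rw [range_comap_of_surjective _ _ hs]
    intro a ha
    obtain ⟨f, rfl⟩ := Ideal.Quotient.mk_surjective a
    have hf : f ∈ originIdeal n R := mem_originIdeal_iff.2 ha
    refine (x.isPrime).mem_of_pow_mem (c + 1) ?_
    rw [← map_pow, Ideal.Quotient.eq_zero_iff_mem.2 (Ideal.pow_mem_pow hf _)]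
    exact zero_mem _
  exact hx

/-- Zariski locally on the base, the automorphism induced by a common étale neighbourhood is realized
by étale coordinates on a ring: an affine open subscheme contains the section over a small enough
open subset of the base. -/
lemma StrictEtaleNbhd.Induces.exists_realizes {E : StrictEtaleNbhd n R} {ρ : discAut n R}
    (h : E.Induces ρ) (p : PrimeSpectrum R) : ∃ f : R, f ∉ p.asIdeal ∧
      ∃ (B : Type u) (_ : CommRing B) (_ : Algebra (Localization.Away f) B) (y z : Fin n → B)
        (τ : B →ₐ[Localization.Away f] Localization.Away f),
        IsEtaleChart (Localization.Away f) y ∧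
          Realizes τ y z (discAutMap (algebraMap R (Localization.Away f)) ρ) := by
  obtain ⟨U, hU, hpU, -⟩ := exists_isAffineOpen_mem_and_subset (X := E.V) (U := ⊤)
    (x := E.τ p) trivial
  obtain ⟨_, ⟨f, rfl⟩, hpf, hfU⟩ :=
    (PrimeSpectrum.isTopologicalBasis_basic_opens (R := R)).exists_subset_of_mem_open
      (show p ∈ (E.τ ⁻¹ᵁ U).carrier from hpU) (E.τ ⁻¹ᵁ U).isOpen
  refine ⟨f, hpf, ?_⟩
  let R' := Localization.Away f
  let a : R →+* R' := algebraMap R R'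
  let B : Type u := Γ(E.V, U)
  let j : Spec (CommRingCat.of B) ⟶ E.V := hU.fromSpec
  have hj : Set.range j = U := hU.range_fromSpec
  have : IsOpenImmersion j := hU.isOpenImmersion_fromSpec
  have lift : ∀ {A : Type u} [CommRing A] (g : Spec (CommRingCat.of A) ⟶ E.V),
      (∀ x, g x ∈ U) → ∃ m : B →+* A, specMap m ≫ j = g := fun {A} _ g hg => by
    have hr : Set.range g ⊆ Set.range j := by
      rw [hj]
      rintro _ ⟨x, rfl⟩
      exact hg x
    refine ⟨(Spec.preimage (IsOpenImmersion.lift j g hr)).hom, ?_⟩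
    change Spec.map (Spec.preimage _) ≫ j = g
    rw [Spec.map_preimage, IsOpenImmersion.lift_fac]
  have coord : ∀ q : E.V ⟶ affineSpace n R, ∃ m : MvPolynomial (Fin n) R →+* B,
      specMap m = j ≫ q := fun q => ⟨(Spec.preimage (j ≫ q)).hom, Spec.map_preimage _⟩
  obtain ⟨ψ, hψ⟩ := coord E.ψ
  obtain ⟨φ, hφ⟩ := coord E.φ
  let _ : Algebra R B := (ψ.comp MvPolynomial.C).toAlgebra
  have haeval : (MvPolynomial.aeval (fun k => ψ (MvPolynomial.X k)) :
      MvPolynomial (Fin n) R →ₐ[R] B).toRingHom = ψ := by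
    refine MvPolynomial.ringHom_ext (fun r => ?_) fun k => ?_
    · change MvPolynomial.aeval _ (MvPolynomial.C r) = _
      rw [MvPolynomial.aeval_C]
      rfl
    · change MvPolynomial.aeval _ (MvPolynomial.X k) = _
      rw [MvPolynomial.aeval_X]
  have hy : IsEtaleChart R fun k => ψ (MvPolynomial.X k) := by
    rw [IsEtaleChart, haeval]
    have := E.etale_ψ
    have h2 : Etale (specMap ψ) := by rw [hψ]; infer_instance
    exact (HasRingHomProperty.Spec_iff (P := @Etale)).1 h2
  -- the section and the jets over `R'`
  have hτU : ∀ x, (specMap a ≫ E.τ) x ∈ U := fun x => by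
    exact hfU ((PrimeSpectrum.localization_away_comap_range R' f).le ⟨x, rfl⟩)
  obtain ⟨τ, hτ⟩ := lift _ hτU
  choose ℓ h1 h2 h3 using h
  have hℓτ : ∀ c, specMap (jetEval n R' c) ≫ specMap (jetBaseChange n a c) ≫ ℓ c =
      specMap a ≫ E.τ := fun c => by
    rw [← h1 c, ← Category.assoc, ← Category.assoc, specMap_comp, specMap_comp]
    refine congrArg (fun q : JetRing n R c →+* R' => specMap q ≫ ℓ c) ?_
    refine Ideal.Quotient.ringHom_ext (RingHom.ext fun g => ?_)
    change MvPowerSeries.constantCoeff (MvPowerSeries.map a g) =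
      a (MvPowerSeries.constantCoeff g)
    simp
  have hℓU : ∀ c x, (specMap (jetBaseChange n a c) ≫ ℓ c) x ∈ U := fun c x => by
    obtain ⟨x', rfl⟩ := specMap_jetEval_surjective c x
    have := hτU x'
    rw [← hℓτ c] at this
    exact this
  choose m hm using fun c => lift _ (hℓU c)
  have hmτ : ∀ c b, jetEval n R' c (m c b) = τ b := fun c b => by
    refine DFunLike.congr_fun (f := (jetEval n R' c).comp (m c)) (specMap_injective ?_) b
    rw [← specMap_comp, ← cancel_mono j, Category.assoc, hm, hℓτ, hτ]
  have hmψ : ∀ c, (m c).comp ψ =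
      (jetBaseChange n a c).comp ((toJet n R c).comp (polyToSeries n R)) := fun c => by
    refine specMap_injective ?_
    rw [← specMap_comp, hψ, ← Category.assoc, hm, Category.assoc, h2, specMap_comp]
  have hmφ : ∀ c, (m c).comp φ = (jetBaseChange n a c).comp ((toJet n R c).comp
      ((ρ.1 : MvPowerSeries (Fin n) R →+* MvPowerSeries (Fin n) R).comp (polyToSeries n R))) :=
    fun c => by
      refine specMap_injective ?_
      rw [← specMap_comp, hφ, ← Category.assoc, hm, Category.assoc, h3, specMap_comp]
  have hjet : ∀ c g, jetBaseChange n a c (toJet n R c g) =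
      toJet n R' c (MvPowerSeries.map a g) := fun c g => rfl
  obtain ⟨C, iC, aC, x, i, τ', hx, -, hC⟩ := hy.exists_baseChange a 1 τ m hmτ
    (fun c s => by
      refine (DFunLike.congr_fun (hmψ c) (MvPolynomial.C s)).trans ?_
      change jetBaseChange n a c (toJet n R c (polyToSeries n R (MvPolynomial.C s))) = _
      rw [hjet, algebraMap_jetRing]
      simp)
    (fun c k => by
      refine (DFunLike.congr_fun (hmψ c) (MvPolynomial.X k)).trans ?_
      change jetBaseChange n a c (toJet n R c (polyToSeries n R (MvPolynomial.X k))) = _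
      rw [hjet]
      simp)
  refine ⟨C, iC, aC, x, fun k => i (φ (MvPolynomial.X k)), τ', hx, fun c => ?_⟩
  obtain ⟨l, l1, l2, l3⟩ := hC c
  refine ⟨l, l1, l2, fun k => ?_⟩
  rw [l3, discAutMap_X]
  refine (DFunLike.congr_fun (hmφ c) (MvPolynomial.X k)).trans ?_
  change jetBaseChange n a c (toJet n R c (ρ.1 (polyToSeries n R (MvPolynomial.X k)))) = _
  rw [hjet]
  simp only [MvPolynomial.coeToMvPowerSeries.ringHom_apply, MvPolynomial.coe_X]
  rfl

/-- Zariski locally on the base, dilations of étale automorphisms are étale. -/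
theorem exists_dilate_mem_etaleAut {ρ : discAut n R} (hρ : ρ ∈ etaleAut n R) (p : PrimeSpectrum R) :
    ∃ f : R, f ∉ p.asIdeal ∧ dilate (discAutMap (algebraMap R (Localization.Away f)) ρ) ∈
      etaleAut n (Polynomial (Localization.Away f)) := by
  obtain ⟨E, hE⟩ := hρ
  obtain ⟨f, hf, B, iB, aB, y, z, τ, hy, H⟩ := hE.exists_realizes p
  exact ⟨f, hf, H.dilate_mem_etaleAut hy⟩

end Localize

end FormalDisc

/-! ### Representations of group-valued prestacks -/

lemma rTensor_smul_tower {k R S M : Type*} [CommRing k] [CommRing R] [CommRing S] [Algebra k R]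
    [Algebra k S] [AddCommGroup M] [Module k M] (f : R →ₐ[k] S) (r : R) (x : R ⊗[k] M) :
    f.toLinearMap.rTensor M (r • x) = f r • f.toLinearMap.rTensor M x := by
  induction x using TensorProduct.induction_on with
  | zero => simp
  | add a b ha hb => rw [smul_add, map_add, ha, hb, map_add, smul_add]
  | tmul a m => simp [TensorProduct.smul_tmul']

/-- Jointly injective linear maps stay jointly injective after tensoring with a vector space. -/
lemma eq_zero_of_forall_rTensor_eq_zero {k M V : Type*} {ι : Type*} {N : ι → Type*} [Field k]
    [AddCommGroup M] [Module k M] [AddCommGroup V] [Module k V] [∀ i, AddCommGroup (N i)]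
    [∀ i, Module k (N i)] (φ : ∀ i, M →ₗ[k] N i) (hφ : ∀ m, (∀ i, φ i m = 0) → m = 0)
    (x : M ⊗[k] V) (hx : ∀ i, (φ i).rTensor V x = 0) : x = 0 := by
  classical
  let b := Module.Basis.ofVectorSpace k V
  refine (TensorProduct.equivFinsuppOfBasisRight b).map_eq_zero_iff.1 (Finsupp.ext fun j => ?_)
  refine hφ _ fun i => ?_
  have key : ∀ y : M ⊗[k] V, φ i (TensorProduct.equivFinsuppOfBasisRight b y j) =
      TensorProduct.equivFinsuppOfBasisRight b ((φ i).rTensor V y) j := fun y => by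
    induction y using TensorProduct.induction_on with
    | zero => simp
    | add y z hy hz => simp only [map_add, Finsupp.add_apply, hy, hz]
    | tmul m v => simp
  rw [key, hx, map_zero, Finsupp.zero_apply]

namespace GroupPrestack.Representation

variable {k : Type u} [Field k] {H : GroupPrestack k}

/-- The map `R ⊗ V → R' ⊗ V` induced by `R → R'`. -/
abbrev extend (V : Type u) [AddCommGroup V] [Module k V] {R R' : CommAlgCat.{u} k} (f : R ⟶ R') :
    R ⊗[k] V →ₗ[k] R' ⊗[k] V :=
  f.hom.toLinearMap.rTensor V

lemma extend_smul (V : Type u) [AddCommGroup V] [Module k V] {R R' : CommAlgCat.{u} k} (f : R ⟶ R')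
    (r : R) (x : R ⊗[k] V) : extend V f (r • x) = f.hom r • extend V f x :=
  rTensor_smul_tower f.hom r x

lemma extend_one_tmul (V : Type u) [AddCommGroup V] [Module k V] {R R' : CommAlgCat.{u} k}
    (f : R ⟶ R') (v : V) : extend V f (1 ⊗ₜ v) = 1 ⊗ₜ v := by
  simp [extend]

lemma rTensor_mem_baseChange {V : Type u} [AddCommGroup V] [Module k V] {R R' : Type u} [CommRing R]
    [CommRing R'] [Algebra k R] [Algebra k R'] (f : R →ₗ[k] R') (W : Submodule k V) {x : R ⊗[k] V}
    (hx : x ∈ W.baseChange R) : f.rTensor V x ∈ W.baseChange R' := by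
  obtain ⟨y, rfl⟩ := hx
  induction y using TensorProduct.induction_on with
  | zero => simp
  | add y z hy hz => rw [map_add, map_add]; exact add_mem hy hz
  | tmul r w =>
    rw [LinearMap.baseChange_tmul, LinearMap.rTensor_tmul]
    exact Submodule.tmul_mem_baseChange_of_mem _ w.2

variable (A : Representation H)

/-- A subspace is a subrepresentation if the group elements over all `R` map its vectors into its base
change. -/
lemma isSubrep_of_forall_one_tmul {W : Submodule k A.V}
    (h : ∀ (R : CommAlgCat.{u} k) (g : H.obj R), ∀ w ∈ W, A.ρ R g (1 ⊗ₜ w) ∈ W.baseChange R) :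
    A.IsSubrep W := fun R g x hx => by
  rw [Submodule.baseChange_eq_span] at hx
  induction hx using Submodule.span_induction with
  | mem x hx =>
    obtain ⟨w, hw, rfl⟩ := hx
    exact h R g w hw
  | zero => rw [map_zero]; exact zero_mem _
  | add x y _ _ hx hy => rw [map_add]; exact add_mem hx hy
  | smul r x _ hx => rw [map_smul]; exact Submodule.smul_mem _ _ hx

lemma ρ_mul_apply (R : CommAlgCat.{u} k) (g h : H.obj R) (x : R ⊗[k] A.V) :
    A.ρ R (g * h) x = A.ρ R g (A.ρ R h x) := by
  rw [map_mul]; rfl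

lemma ρ_one_apply (R : CommAlgCat.{u} k) (x : R ⊗[k] A.V) : A.ρ R 1 x = x := by
  rw [map_one]; rfl

/-- Representations of a group-valued prestack with a versal element `u` over a ring `O` are locally
finite: if `u v = ∑ eᵢ ⊗ wᵢ` for a basis `eᵢ` of `O`, then the `wᵢ` span a subrepresentation. -/
theorem isLocallyFinite_of_versal (O : CommAlgCat.{u} k) (u : H.obj O)
    (hu : ∀ (R : CommAlgCat.{u} k) (g : H.obj R), ∃ f : O ⟶ R, H.map f u = g) :
    IsLocallyFinite A := by
  classical
  intro v
  let e := Module.Basis.ofVectorSpace k O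
  let Y := A.ρ O u (1 ⊗ₜ v)
  let b := TensorProduct.equivFinsuppOfBasisLeft e Y
  have hY : Y = b.sum fun i w => e i ⊗ₜ w := by
    rw [← TensorProduct.equivFinsuppOfBasisLeft_symm_apply, LinearEquiv.symm_apply_apply]
  let W : Submodule k A.V := Submodule.span k (b '' b.support)
  have hbW : ∀ i, b i ∈ W := fun i => by
    by_cases hi : i ∈ b.support
    · exact Submodule.subset_span ⟨i, hi, rfl⟩
    · rw [Finsupp.notMem_support_iff.1 hi]; exact zero_mem _
  have hYW : Y ∈ W.baseChange O := by
    rw [hY]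
    exact Submodule.sum_mem _ fun i _ => Submodule.tmul_mem_baseChange_of_mem _ (hbW i)
  refine ⟨W, A.isSubrep_of_forall_one_tmul fun R g w hw => ?_,
    FiniteDimensional.span_of_finite k (b.support.finite_toSet.image b), ?_⟩
  · -- contract `(g u) v`, over `R ⊗ O`, with the coordinate functionals of `O`
    let P : CommAlgCat.{u} k := CommAlgCat.of k (R ⊗[k] O)
    let iR : R ⟶ P := CommAlgCat.ofHom Algebra.TensorProduct.includeLeft
    let iO : O ⟶ P := CommAlgCat.ofHom Algebra.TensorProduct.includeRight
    obtain ⟨F, hF⟩ := hu P (H.map iR g * H.map iO u)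
    have h1 : extend A.V F Y = A.ρ P (H.map iR g) (extend A.V iO Y) := by
      rw [A.natural, A.natural, hF, A.ρ_mul_apply, extend_one_tmul, extend_one_tmul]
    let c : (i : _) → P →ₗ[k] R := fun i =>
      (TensorProduct.rid k R).toLinearMap ∘ₗ (e.coord i).lTensor R
    have hc : ∀ i (r : R) (o : O), c i (r ⊗ₜ o) = e.coord i o • r := fun i r o => by
      change TensorProduct.rid k R ((e.coord i).lTensor R (r ⊗ₜ o)) = _
      rw [LinearMap.lTensor_tmul, TensorProduct.rid_tmul]
    have hcR : ∀ i (r : R) (p : P), c i (iR.hom r * p) = r * c i p := fun i r p => by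
      induction p using TensorProduct.induction_on with
      | zero => rw [mul_zero, map_zero, mul_zero]
      | add p q hp hq => rw [mul_add, map_add, hp, hq, map_add, mul_add]
      | tmul r' o =>
        have : iR.hom r * r' ⊗ₜ o = (r * r') ⊗ₜ[k] o := by
          change (r ⊗ₜ 1) * (r' ⊗ₜ o) = _
          rw [Algebra.TensorProduct.tmul_mul_tmul, one_mul]
        rw [this, hc, hc, mul_smul_comm]
    have hcg : ∀ i (o : O) (z : R ⊗[k] A.V),
        (c i).rTensor A.V (iO.hom o • extend A.V iR z) = e.coord i o • z := fun i o z => by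
      induction z using TensorProduct.induction_on with
      | zero => simp
      | add y z hy hz => rw [map_add, smul_add, map_add, hy, hz, smul_add]
      | tmul r w =>
        change (c i).rTensor A.V ((iO.hom o * iR.hom r) ⊗ₜ w) = _
        rw [LinearMap.rTensor_tmul, mul_comm, hcR]
        change (r * c i (1 ⊗ₜ o)) ⊗ₜ w = _
        rw [hc, mul_smul_comm, mul_one, TensorProduct.smul_tmul']
    have h2 : ∀ i, (c i).rTensor A.V (extend A.V F Y) = A.ρ R g (1 ⊗ₜ b i) := fun i => by
      rw [h1, hY, Finsupp.sum, map_sum, map_sum, map_sum]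
      have : ∀ j, (c i).rTensor A.V (A.ρ P (H.map iR g) (extend A.V iO (e j ⊗ₜ b j))) =
          e.coord i (e j) • A.ρ R g (1 ⊗ₜ b j) := fun j => by
        have h3 : extend A.V iO (e j ⊗ₜ b j) = iO.hom (e j) • extend A.V iR (1 ⊗ₜ b j) := by
          rw [extend_one_tmul, TensorProduct.smul_tmul', smul_eq_mul, mul_one]
          rfl
        rw [h3, map_smul, ← A.natural, hcg]
      simp only [this, Module.Basis.coord_apply, Module.Basis.repr_self, Finsupp.single_apply, ite_smul,
        one_smul, zero_smul, Finset.sum_ite_eq']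
      split_ifs with hi
      · rfl
      · rw [Finsupp.notMem_support_iff.1 hi, TensorProduct.tmul_zero, map_zero]
    induction hw using Submodule.span_induction with
    | mem w hw =>
      obtain ⟨i, -, rfl⟩ := hw
      rw [← h2]
      exact rTensor_mem_baseChange _ W (rTensor_mem_baseChange _ W hYW)
    | zero => rw [TensorProduct.tmul_zero, map_zero]; exact zero_mem _
    | add x y _ _ hx hy => rw [TensorProduct.tmul_add, map_add]; exact add_mem hx hy
    | smul a x _ hx =>
      rw [TensorProduct.tmul_smul, ← algebraMap_smul R a, map_smul]
      exact Submodule.smul_mem _ _ hx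
  · obtain ⟨f, hf⟩ := hu (CommAlgCat.of k k) 1
    have h1 : extend A.V f Y = 1 ⊗ₜ v := by
      rw [A.natural, hf, A.ρ_one_apply, extend_one_tmul]
    have h2 := congrArg (TensorProduct.lid k A.V) h1
    rw [TensorProduct.lid_tmul, one_smul, hY, Finsupp.sum, map_sum, map_sum] at h2
    rw [← h2]
    exact Submodule.sum_mem _ fun i _ => Submodule.smul_mem _ _ (hbW i)

/-! ### Degrees in the dilation parameter -/

section Degree

open LaurentPolynomial

variable {k : Type u} [Field k]

/-- The `k`-algebra of Laurent polynomials over `R`. -/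
abbrev laurent (R : CommAlgCat.{u} k) : CommAlgCat.{u} k := CommAlgCat.of k (LaurentPolynomial R)

/-- The coefficient of `λ ^ i` of a Laurent polynomial. -/
def laurentCoeff (k R : Type*) [Field k] [CommRing R] [Algebra k R] (i : ℤ) :
    LaurentPolynomial R →ₗ[k] R where
  toFun p := p.coeff i
  map_add' _ _ := rfl
  map_smul' _ _ := rfl

lemma laurentCoeff_apply (R : Type*) [CommRing R] [Algebra k R] (i : ℤ) (p : LaurentPolynomial R) :
    laurentCoeff k R i p = p.coeff i := rfl

lemma laurentCoeff_C_mul_T_mul (R : Type*) [CommRing R] [Algebra k R] (i j : ℤ) (r : R)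
    (p : LaurentPolynomial R) :
    laurentCoeff k R i (C r * T j * p) = r * laurentCoeff k R (i - j) p := by
  induction p using LaurentPolynomial.induction_on' with
  | add p q hp hq => rw [mul_add, map_add, hp, hq, map_add, mul_add]
  | C_mul_T m a =>
    have : C r * T j * (C a * T m) = C (r * a) * T (j + m) := by
      rw [map_mul, T_add]; ring
    rw [this, ← single_eq_C_mul_T, ← single_eq_C_mul_T, laurentCoeff_apply, laurentCoeff_apply]
    simp only [AddMonoidAlgebra.coeff_single, Finsupp.single_apply]
    by_cases h : j + m = i
    · rw [if_pos h, if_pos (by omega)]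
    · rw [if_neg h, if_neg (by omega), mul_zero]

variable (V : Type u) [AddCommGroup V] [Module k V]

/-- The elements of `R[λ, λ⁻¹] ⊗ V` of degree at most `N` in `λ`. -/
def degreeLE (R : CommAlgCat.{u} k) (N : ℤ) : Submodule k (laurent R ⊗[k] V) :=
  ⨅ i : ℤ, ⨅ _ : N < i, LinearMap.ker ((laurentCoeff k R i).rTensor V)

variable {V}

lemma mem_degreeLE {R : CommAlgCat.{u} k} {N : ℤ} {x : laurent R ⊗[k] V} :
    x ∈ degreeLE V R N ↔ ∀ i, N < i → (laurentCoeff k R i).rTensor V x = 0 := by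
  simp only [degreeLE, Submodule.mem_iInf, LinearMap.mem_ker]

lemma degreeLE_mono {R : CommAlgCat.{u} k} {M N : ℤ} (h : M ≤ N) : degreeLE V R M ≤ degreeLE V R N :=
  fun _ hx => mem_degreeLE.2 fun i hi => mem_degreeLE.1 hx i (h.trans_lt hi)

lemma rTensor_laurentCoeff_smul {R : CommAlgCat.{u} k} (i j : ℤ) (r : R) (x : laurent R ⊗[k] V) :
    (laurentCoeff k R i).rTensor V ((C r * T j : LaurentPolynomial R) • x) =
      r • (laurentCoeff k R (i - j)).rTensor V x := by
  induction x using TensorProduct.induction_on with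
  | zero => simp
  | add x y hx hy => rw [smul_add, map_add, hx, hy, map_add, smul_add]
  | tmul p v =>
    rw [TensorProduct.smul_tmul', smul_eq_mul, LinearMap.rTensor_tmul, LinearMap.rTensor_tmul,
      TensorProduct.smul_tmul', smul_eq_mul]
    exact congrArg (· ⊗ₜ v) (laurentCoeff_C_mul_T_mul (k := k) R i j r p)

lemma C_mul_T_smul_mem_degreeLE {R : CommAlgCat.{u} k} {N : ℤ} (j : ℤ) (r : R)
    {x : laurent R ⊗[k] V} (hx : x ∈ degreeLE V R N) :
    (C r * T j : LaurentPolynomial R) • x ∈ degreeLE V R (N + j) :=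
  mem_degreeLE.2 fun i hi => by
    rw [rTensor_laurentCoeff_smul, mem_degreeLE.1 hx _ (by omega), smul_zero]

lemma exists_mem_degreeLE {R : CommAlgCat.{u} k} (x : laurent R ⊗[k] V) :
    ∃ N, x ∈ degreeLE V R N := by
  induction x using TensorProduct.induction_on with
  | zero => exact ⟨0, zero_mem _⟩
  | add x y hx hy =>
    obtain ⟨M, hM⟩ := hx
    obtain ⟨N, hN⟩ := hy
    exact ⟨max M N, add_mem (degreeLE_mono (le_max_left _ _) hM) (degreeLE_mono (le_max_right _ _) hN)⟩
  | tmul p v =>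
    induction p using LaurentPolynomial.induction_on' with
    | add p q hp hq =>
      obtain ⟨M, hM⟩ := hp
      obtain ⟨N, hN⟩ := hq
      refine ⟨max M N, ?_⟩
      rw [TensorProduct.add_tmul]
      exact add_mem (degreeLE_mono (le_max_left _ _) hM) (degreeLE_mono (le_max_right _ _) hN)
    | C_mul_T m a =>
      refine ⟨m, mem_degreeLE.2 fun i hi => ?_⟩
      have h : laurentCoeff k R i (C a * T m) = 0 := by
        rw [← single_eq_C_mul_T, laurentCoeff_apply, AddMonoidAlgebra.coeff_single,
          Finsupp.single_apply, if_neg (by omega)]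
      rw [LinearMap.rTensor_tmul, h, TensorProduct.zero_tmul]

/-- The inclusion of the constants `R → R[λ, λ⁻¹]`. -/
def constHom (R : CommAlgCat.{u} k) : R ⟶ laurent R :=
  CommAlgCat.ofHom (IsScalarTower.toAlgHom k R (LaurentPolynomial R))

lemma constHom_apply (R : CommAlgCat.{u} k) (r : R) : (constHom R).hom r = C r := rfl

/-- The map `k[λ, λ⁻¹] → R[λ, λ⁻¹]`. -/
def coeffHom (R : CommAlgCat.{u} k) : laurent (CommAlgCat.of k k) ⟶ laurent R :=
  CommAlgCat.ofHom
    { toRingHom := LaurentPolynomial.eval₂ (algebraMap k (LaurentPolynomial R)) (isUnit_T 1).unit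
      commutes' := fun a => by
        change LaurentPolynomial.eval₂ _ _ (C a) = _
        rw [eval₂_C] }

lemma coeffHom_C_mul_T (R : CommAlgCat.{u} k) (a : k) (m : ℤ) :
    (coeffHom R).hom (C a * T m) = C (algebraMap k R a) * T m := by
  refine (eval₂_C_mul_T _ _ a m).trans ?_
  have h : ∀ m : ℤ, (((isUnit_T 1).unit ^ m : (LaurentPolynomial R)ˣ) : LaurentPolynomial R) = T m := by
    intro m
    have h1 : (isUnit_T 1).unit⁻¹.val = (T (-1) : LaurentPolynomial R) := by
      rw [← mul_one (isUnit_T 1).unit⁻¹.val, ← T_zero, ← add_neg_cancel (1 : ℤ), T_add, ← mul_assoc,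
        IsUnit.val_inv_mul, one_mul]
    induction m with
    | zero => simp
    | succ i hi => rw [zpow_add_one, Units.val_mul, hi, T_add]; rfl
    | pred i hi => rw [zpow_sub_one, Units.val_mul, hi, h1, ← T_add]; rfl
  rw [h]
  rfl

lemma extend_coeffHom_mem_degreeLE (R : CommAlgCat.{u} k) {N : ℤ}
    {x : laurent (CommAlgCat.of k k) ⊗[k] V} (hx : x ∈ degreeLE V (CommAlgCat.of k k) N) :
    extend V (coeffHom R) x ∈ degreeLE V R N := mem_degreeLE.2 fun i hi => by
  have h : ∀ p, laurentCoeff k R i ((coeffHom R).hom p) = algebraMap k R (laurentCoeff k k i p) :=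
    fun p => by
      induction p using LaurentPolynomial.induction_on' with
      | add p q hp hq => rw [map_add, map_add, hp, hq, map_add, map_add]
      | C_mul_T m a =>
        rw [coeffHom_C_mul_T, ← single_eq_C_mul_T, ← single_eq_C_mul_T, laurentCoeff_apply,
          laurentCoeff_apply, AddMonoidAlgebra.coeff_single, AddMonoidAlgebra.coeff_single,
          Finsupp.single_apply, Finsupp.single_apply]
        split_ifs <;> simp
  have e : (laurentCoeff k R i) ∘ₗ (coeffHom R).hom.toLinearMap =
      (Algebra.linearMap k R) ∘ₗ laurentCoeff k k i := LinearMap.ext h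
  rw [extend, ← LinearMap.comp_apply, ← LinearMap.rTensor_comp, e, LinearMap.rTensor_comp,
    LinearMap.comp_apply]
  have := mem_degreeLE.1 hx i hi
  change (Algebra.linearMap k R).rTensor V ((laurentCoeff k k i).rTensor V x) = 0
  rw [this, map_zero]

lemma smul_mem_degreeLE_uniform (p : LaurentPolynomial k) (M : ℤ) : ∃ N, ∀ (R : CommAlgCat.{u} k),
    ∀ x ∈ degreeLE V R M, (coeffHom R).hom p • x ∈ degreeLE V R N := by
  induction p using LaurentPolynomial.induction_on' with
  | add p q hp hq =>
    obtain ⟨N, hN⟩ := hp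
    obtain ⟨N', hN'⟩ := hq
    refine ⟨max N N', fun R x hx => ?_⟩
    rw [map_add, add_smul]
    exact add_mem (degreeLE_mono (le_max_left _ _) (hN R x hx))
      (degreeLE_mono (le_max_right _ _) (hN' R x hx))
  | C_mul_T m a =>
    refine ⟨M + m, fun R x hx => ?_⟩
    rw [coeffHom_C_mul_T]
    exact C_mul_T_smul_mem_degreeLE _ _ hx

variable {H : GroupPrestack k} (A : Representation H)

/-- The image in `H(R[λ, λ⁻¹])` of an element of `H(k[λ, λ⁻¹])`. -/
abbrev pull (s : H.obj (laurent (CommAlgCat.of k k))) (R : CommAlgCat.{u} k) : H.obj (laurent R) :=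
  H.map (coeffHom R) s

lemma exists_pull_mem_degreeLE (s : H.obj (laurent (CommAlgCat.of k k))) (W : Submodule k A.V)
    [FiniteDimensional k W] : ∃ M, ∀ (R : CommAlgCat.{u} k), ∀ z ∈ W.baseChange R,
      A.ρ _ (pull s R) (extend A.V (constHom R) z) ∈ degreeLE A.V R M := by
  have h1 : ∃ M, ∀ w ∈ W, A.ρ _ s (1 ⊗ₜ w) ∈ degreeLE A.V (CommAlgCat.of k k) M := by
    obtain ⟨S, rfl⟩ := (Submodule.fg_iff_finiteDimensional W).2 ‹_›
    choose N hN using fun w : A.V => exists_mem_degreeLE (A.ρ _ s (1 ⊗ₜ w))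
    obtain ⟨M, hM⟩ := (S.image N).bddAbove
    refine ⟨M, fun w hw => ?_⟩
    induction hw using Submodule.span_induction with
    | mem w hw => exact degreeLE_mono (hM (Finset.mem_image_of_mem _ hw)) (hN w)
    | zero => rw [TensorProduct.tmul_zero, map_zero]; exact zero_mem _
    | add x y _ _ hx hy => rw [TensorProduct.tmul_add, map_add]; exact add_mem hx hy
    | smul a x _ hx =>
      rw [TensorProduct.tmul_smul, ← algebraMap_smul (laurent (CommAlgCat.of k k)) a, map_smul,
        algebraMap_smul]
      exact Submodule.smul_mem _ _ hx
  obtain ⟨M, hM⟩ := h1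
  refine ⟨M, fun R z hz => ?_⟩
  rw [Submodule.baseChange_eq_span] at hz
  induction hz using Submodule.span_induction with
  | mem z hz =>
    obtain ⟨w, hw, rfl⟩ := hz
    change A.ρ _ (pull s R) (extend A.V (constHom R) (1 ⊗ₜ w)) ∈ _
    rw [extend_one_tmul, ← extend_one_tmul A.V (coeffHom R), ← A.natural]
    exact extend_coeffHom_mem_degreeLE R (hM w hw)
  | zero => rw [map_zero, map_zero]; exact zero_mem _
  | add x y _ _ hx hy => rw [map_add, map_add]; exact add_mem hx hy
  | smul r x _ hx =>
    rw [extend_smul, map_smul, constHom_apply]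
    have := C_mul_T_smul_mem_degreeLE 0 r hx
    rwa [T_zero, mul_one, add_zero] at this

/-- Conjugates of elements of `H(R)` by an element of `H(k[λ, λ⁻¹])` move a vector of a
finite-dimensional subrepresentation by a Laurent polynomial of bounded degree. -/
lemma exists_conj_mem_degreeLE (s : H.obj (laurent (CommAlgCat.of k k))) {W : Submodule k A.V}
    (hW : A.IsSubrep W) [FiniteDimensional k W] {v : A.V} (hv : v ∈ W) :
    ∃ N, ∀ (R : CommAlgCat.{u} k) (h : H.obj R),
      A.ρ _ (pull s R * H.map (constHom R) h * (pull s R)⁻¹) (1 ⊗ₜ v) ∈ degreeLE A.V R N := by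
  obtain ⟨M, hM⟩ := exists_pull_mem_degreeLE A s W
  have h1 : ∀ y ∈ W.baseChange (laurent (CommAlgCat.of k k)), ∃ N, ∀ (R : CommAlgCat.{u} k)
      (h : H.obj R), A.ρ _ (pull s R) (A.ρ _ (H.map (constHom R) h) (extend A.V (coeffHom R) y)) ∈
        degreeLE A.V R N := by
    intro y hy
    rw [Submodule.baseChange_eq_span] at hy
    induction hy using Submodule.span_induction with
    | mem z hz =>
      obtain ⟨w, hw, rfl⟩ := hz
      refine ⟨M, fun R h => ?_⟩
      change A.ρ _ _ (A.ρ _ _ (extend A.V (coeffHom R) (1 ⊗ₜ w))) ∈ _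
      rw [extend_one_tmul, ← extend_one_tmul A.V (constHom R), ← A.natural]
      exact hM R _ (hW R h _ (Submodule.tmul_mem_baseChange_of_mem _ hw))
    | zero => exact ⟨0, fun R h => by rw [map_zero, map_zero, map_zero]; exact zero_mem _⟩
    | add x y _ _ hx hy =>
      obtain ⟨N, hN⟩ := hx
      obtain ⟨N', hN'⟩ := hy
      refine ⟨max N N', fun R h => ?_⟩
      rw [map_add, map_add, map_add]
      exact add_mem (degreeLE_mono (le_max_left _ _) (hN R h))
        (degreeLE_mono (le_max_right _ _) (hN' R h))
    | smul p x _ hx =>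
      obtain ⟨N, hN⟩ := hx
      obtain ⟨N', hN'⟩ := smul_mem_degreeLE_uniform (V := A.V) p N
      refine ⟨N', fun R h => ?_⟩
      rw [extend_smul, map_smul, map_smul]
      exact hN' R _ (hN R h)
  obtain ⟨N, hN⟩ := h1 (A.ρ _ s⁻¹ (1 ⊗ₜ v)) (hW _ _ _ (Submodule.tmul_mem_baseChange_of_mem _ hv))
  refine ⟨N, fun R h => ?_⟩
  have := hN R h
  rwa [A.natural, extend_one_tmul, map_inv, ← A.ρ_mul_apply, ← A.ρ_mul_apply] at this

end Degree

/-! ### Automorphisms close to the identity act trivially -/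

section JetBound

variable {k : Type u} [Field k] {n : ℕ} {H : GroupPrestack k}

/-- The automorphism of the formal disc over `R` given by an element of `H(R)`. -/
abbrev toDisc (ι : H ⟶ FormalDisc.K k n) {R : CommAlgCat.{u} k} (h : H.obj R) :
    FormalDisc.discAut n R :=
  ι.app R h

lemma toDisc_map (ι : H ⟶ FormalDisc.K k n) {R R' : CommAlgCat.{u} k} (f : R ⟶ R') (h : H.obj R) :
    toDisc ι (H.map f h) = FormalDisc.discAutMap f.hom.toRingHom (toDisc ι h) :=
  ConcreteCategory.congr_hom (ι.naturality f) h

lemma toDisc_mul (ι : H ⟶ FormalDisc.K k n) {R : CommAlgCat.{u} k} (g h : H.obj R) :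
    toDisc ι (g * h) = toDisc ι g * toDisc ι h :=
  map_mul (ι.app R).hom g h

lemma toDisc_one (ι : H ⟶ FormalDisc.K k n) {R : CommAlgCat.{u} k} :
    toDisc ι (1 : H.obj R) = 1 :=
  map_one (ι.app R).hom

/-- `ι` identifies `H` with a prestack of automorphisms of the formal disc that contains the scalings
and, Zariski locally on the base, the dilations of its elements. -/
structure IsDilatable (ι : H ⟶ FormalDisc.K k n) : Prop where
  injective : ∀ (R : CommAlgCat.{u} k) (g h : H.obj R), toDisc ι g = toDisc ι h → g = h
  exists_scaling : ∀ (R : CommAlgCat.{u} k) (u : Rˣ), ∃ s : H.obj R,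
    toDisc ι s = FormalDisc.scaling n u
  exists_dilate : ∀ (R : CommAlgCat.{u} k) (h : H.obj R) (p : PrimeSpectrum R), ∃ f : R,
    f ∉ p.asIdeal ∧ ∃ h' : H.obj (CommAlgCat.of k (Polynomial (Localization.Away f))),
      toDisc ι h' = FormalDisc.dilate
        (FormalDisc.discAutMap (algebraMap R (Localization.Away f)) (toDisc ι h))

/-- The coefficient of `λ ^ i` of a polynomial. -/
def polyCoeff (k R : Type*) [Field k] [CommRing R] [Algebra k R] (i : ℕ) : Polynomial R →ₗ[k] R :=
  (Polynomial.lcoeff R i).restrictScalars k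

/-- The inclusion `R[λ] → R[λ, λ⁻¹]`. -/
def polyToLaurent (R : CommAlgCat.{u} k) : CommAlgCat.of k (Polynomial R) ⟶ laurent R :=
  CommAlgCat.ofHom ((Polynomial.toLaurentAlg (R := R)).restrictScalars k)

lemma laurentCoeff_comp_polyToLaurent (R : CommAlgCat.{u} k) (i : ℕ) :
    laurentCoeff k R i ∘ₗ (polyToLaurent R).hom.toLinearMap = polyCoeff k R i := by
  refine LinearMap.ext fun p => ?_
  change laurentCoeff k R i (Polynomial.toLaurent p) = p.coeff i
  induction p using Polynomial.induction_on' with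
  | add p q hp hq => rw [map_add, map_add, hp, hq, Polynomial.coeff_add]
  | monomial m a =>
    rw [← Polynomial.C_mul_X_pow_eq_monomial, Polynomial.toLaurent_C_mul_X_pow,
      ← LaurentPolynomial.single_eq_C_mul_T, laurentCoeff_apply, AddMonoidAlgebra.coeff_single,
      Finsupp.single_apply, Polynomial.coeff_C_mul_X_pow]
    simp only [Nat.cast_inj, eq_comm]

/-- Over `R[λ, λ⁻¹]`, the dilation is the conjugate by the scaling `s : t ↦ λ t`. -/
lemma map_polyToLaurent_dilate {ι : H ⟶ FormalDisc.K k n} (hι : IsDilatable ι)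
    {s : H.obj (laurent (CommAlgCat.of k k))}
    (hs : toDisc ι s = FormalDisc.scaling n (LaurentPolynomial.isUnit_T 1).unit)
    {R : CommAlgCat.{u} k} {h : H.obj R} {h' : H.obj (CommAlgCat.of k (Polynomial R))}
    (hh' : toDisc ι h' = FormalDisc.dilate (toDisc ι h)) :
    H.map (polyToLaurent R) h' = pull s R * H.map (constHom R) h * (pull s R)⁻¹ := by
  refine eq_mul_inv_of_mul_eq (hι.injective _ _ _ ?_)
  let w : (LaurentPolynomial R)ˣ :=
    Units.map ((coeffHom R).hom.toRingHom : LaurentPolynomial k →+* LaurentPolynomial R).toMonoidHom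
      (LaurentPolynomial.isUnit_T 1).unit
  have hw : (polyToLaurent R).hom.toRingHom Polynomial.X = (w : LaurentPolynomial R) := by
    have h1 : (polyToLaurent R).hom.toRingHom Polynomial.X = LaurentPolynomial.T 1 :=
      Polynomial.toLaurent_X
    have h2 : (w : LaurentPolynomial R) = LaurentPolynomial.T 1 := by
      have := coeffHom_C_mul_T R 1 1
      rw [map_one, map_one, map_one, one_mul, one_mul] at this
      exact this
    exact h1.trans h2.symm
  have h1 : toDisc ι (pull s R) = FormalDisc.scaling n w :=
    (toDisc_map ι _ s).trans ((congrArg _ hs).trans (FormalDisc.discAutMap_scaling _ _))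
  have h2 : toDisc ι (H.map (polyToLaurent R) h') =
      FormalDisc.discAutMap (polyToLaurent R).hom.toRingHom (FormalDisc.dilate (toDisc ι h)) :=
    (toDisc_map ι _ h').trans (congrArg _ hh')
  have h3 : toDisc ι (H.map (constHom R) h) = FormalDisc.discAutMap
      ((polyToLaurent R).hom.toRingHom.comp Polynomial.C) (toDisc ι h) := by
    refine (toDisc_map ι _ h).trans (congrArg (fun f => FormalDisc.discAutMap f (toDisc ι h)) ?_)
    exact RingHom.ext fun r => (Polynomial.toLaurent_C r).symm
  have h4 := FormalDisc.discAutMap_dilate_mul_scaling (toDisc ι h) _ w hw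
  exact ((toDisc_mul ι _ _).trans (congrArg₂ (· * ·) h2 h1)).trans
    (h4.trans ((toDisc_mul ι _ _).trans (congrArg₂ (· * ·) h1 h3)).symm)

variable (A : Representation H)

/-- A polynomial family of group elements which is trivial modulo `λ ^ c` does not move a vector in
degrees below `c`. -/
lemma rTensor_polyCoeff_eq_zero {ι : H ⟶ FormalDisc.K k n} (hι : IsDilatable ι)
    {R : CommAlgCat.{u} k} {h : H.obj R} {h' : H.obj (CommAlgCat.of k (Polynomial R))}
    (hh' : toDisc ι h' = FormalDisc.dilate (toDisc ι h)) {c : ℕ}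
    (hjet : FormalDisc.JetCongr c (toDisc ι h) 1) (x : CommAlgCat.of k (Polynomial R) ⊗[k] A.V)
    {i : ℕ} (hi : i < c) : (polyCoeff k R i).rTensor A.V (A.ρ _ h' x - x) = 0 := by
  let I : Ideal (Polynomial R) := Ideal.span {Polynomial.X ^ c}
  let π : CommAlgCat.of k (Polynomial R) ⟶ CommAlgCat.of k (Polynomial R ⧸ I) :=
    CommAlgCat.ofHom (Ideal.Quotient.mkₐ k I)
  have h1 : H.map π h' = 1 := by
    refine hι.injective _ _ _ ?_
    refine (toDisc_map ι π h').trans ((congrArg _ hh').trans (Eq.trans ?_ (toDisc_one ι).symm))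
    refine FormalDisc.discAutMap_dilate_of_pow_eq_zero hjet _ ?_
    rw [← map_pow]
    exact Ideal.Quotient.eq_zero_iff_mem.2 (Ideal.subset_span rfl)
  have h2 : extend A.V π (A.ρ _ h' x - x) = 0 := by
    rw [map_sub, A.natural, h1, A.ρ_one_apply, sub_self]
  let ιI : (I.restrictScalars k) →ₗ[k] Polynomial R := (I.restrictScalars k).subtype
  have hex : Function.Exact ιI π.hom.toLinearMap := fun p => by
    refine Ideal.Quotient.eq_zero_iff_mem.trans ?_
    exact ⟨fun h => ⟨⟨p, h⟩, rfl⟩, by rintro ⟨q, rfl⟩; exact q.2⟩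
  obtain ⟨y, hy⟩ := (rTensor_exact A.V hex Ideal.Quotient.mk_surjective _).1 h2
  have h3 : polyCoeff k R i ∘ₗ ιI = 0 := by
    refine LinearMap.ext fun q => ?_
    obtain ⟨q', hq'⟩ := Ideal.mem_span_singleton.1 q.2
    change Polynomial.coeff q.1 i = 0
    rw [hq', Polynomial.coeff_X_pow_mul', if_neg (by omega)]
  rw [← hy, ← LinearMap.comp_apply, ← LinearMap.rTensor_comp, h3, LinearMap.rTensor_zero,
    LinearMap.zero_apply]

/-- The dilation `h'` of `h` moves `v` by a polynomial in `λ` of bounded degree, as it is a conjugate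
of `h` over `R[λ, λ⁻¹]`; if `h` is trivial to high order, this polynomial is constant, as `h'` is
trivial modulo a high power of `λ`. At `λ = 1` one recovers `h`. -/
lemma IsDilatable.exists_bound_of_dilate {ι : H ⟶ FormalDisc.K k n} (hι : IsDilatable ι)
    {W : Submodule k A.V} (hW : A.IsSubrep W) [FiniteDimensional k W] {v : A.V} (hv : v ∈ W) :
    ∃ N : ℕ, ∀ (R : CommAlgCat.{u} k) (h : H.obj R) (h' : H.obj (CommAlgCat.of k (Polynomial R))),
      toDisc ι h' = FormalDisc.dilate (toDisc ι h) → FormalDisc.JetCongr N (toDisc ι h) 1 →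
        A.ρ R h (1 ⊗ₜ v) = 1 ⊗ₜ v := by
  obtain ⟨s, hs⟩ := hι.exists_scaling (laurent (CommAlgCat.of k k)) (LaurentPolynomial.isUnit_T 1).unit
  obtain ⟨N, hN⟩ := A.exists_conj_mem_degreeLE s hW hv
  -- the bound is positive, so that the constant coefficient, in which `1 ⊗ v` sits, is among the low ones
  refine ⟨N.toNat + 1, fun R h h' hh' hjet => ?_⟩
  have hdeg := hN R h
  rw [← map_polyToLaurent_dilate hι hs hh', ← extend_one_tmul A.V (polyToLaurent R),
    ← A.natural] at hdeg
  have hx : A.ρ _ h' (1 ⊗ₜ v) - 1 ⊗ₜ v = 0 := by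
    refine eq_zero_of_forall_rTensor_eq_zero (polyCoeff k R) (fun p hp => Polynomial.ext hp) _
      fun i => ?_
    by_cases hi : i < N.toNat + 1
    · exact rTensor_polyCoeff_eq_zero A hι hh' hjet _ hi
    · have h1 : (polyCoeff k R i).rTensor A.V (A.ρ _ h' (1 ⊗ₜ v)) = 0 := by
        rw [← laurentCoeff_comp_polyToLaurent, LinearMap.rTensor_comp, LinearMap.comp_apply]
        exact mem_degreeLE.1 hdeg i (by omega)
      have h2 : (polyCoeff k R i).rTensor A.V (1 ⊗ₜ v) = 0 := by
        rw [LinearMap.rTensor_tmul]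
        change (Polynomial.coeff (1 : Polynomial R) i) ⊗ₜ v = _
        rw [Polynomial.coeff_one, if_neg (by omega), TensorProduct.zero_tmul]
      rw [map_sub, h1, h2, sub_zero]
  let ev : CommAlgCat.of k (Polynomial R) ⟶ R :=
    CommAlgCat.ofHom ((Polynomial.aeval (R := R) (1 : R)).restrictScalars k)
  have hev : H.map ev h' = h := by
    refine hι.injective _ _ _ ?_
    refine (toDisc_map ι ev h').trans ((congrArg _ hh').trans ?_)
    exact FormalDisc.discAutMap_dilate_of_one _ _ (fun r => Polynomial.aeval_C _ r)
      (Polynomial.aeval_X _)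
  have := congrArg (extend A.V ev) (sub_eq_zero.1 hx)
  rwa [A.natural, extend_one_tmul, hev] at this

/-- An element that vanishes on a Zariski cover is zero. -/
lemma eq_zero_of_forall_localization {R : Type*} [CommRing R] {f : PrimeSpectrum R → R}
    (hf : ∀ p, f p ∉ p.asIdeal) {r : R}
    (hr : ∀ p, algebraMap R (Localization.Away (f p)) r = 0) : r = 0 := by
  by_contra hr0
  have hne : Module.annihilator R (Submodule.span R {r}) ≠ ⊤ := fun h => by
    have h1 : (1 : R) ∈ Module.annihilator R (Submodule.span R {r}) := h ▸ Submodule.mem_top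
    rw [Submodule.mem_annihilator_span_singleton, one_smul] at h1
    exact hr0 h1
  obtain ⟨m, hm, hle⟩ := Ideal.exists_le_maximal _ hne
  let p : PrimeSpectrum R := ⟨m, hm.isPrime⟩
  obtain ⟨⟨_, c, rfl⟩, hc⟩ := (IsLocalization.map_eq_zero_iff (Submonoid.powers (f p)) _ r).1 (hr p)
  exact hf p (hm.isPrime.mem_of_pow_mem c
    (hle ((Submodule.mem_annihilator_span_singleton _ _).2 hc)))

/-- Elements of `H(R)` that are trivial to sufficiently high order fix a given vector of a locally
finite representation, for all `R` at once. -/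
theorem IsDilatable.exists_jet_bound {ι : H ⟶ FormalDisc.K k n} (hι : IsDilatable ι)
    (hA : IsLocallyFinite A) (v : A.V) : ∃ N : ℕ, ∀ (R : CommAlgCat.{u} k) (h : H.obj R),
      FormalDisc.JetCongr N (toDisc ι h) 1 → A.ρ R h (1 ⊗ₜ v) = 1 ⊗ₜ v := by
  obtain ⟨W, hW, _, hv⟩ := hA v
  obtain ⟨N, hN⟩ := hι.exists_bound_of_dilate A hW hv
  refine ⟨N, fun R h hjet => sub_eq_zero.1 ?_⟩
  choose f hf h' hh' using hι.exists_dilate R h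
  let π : ∀ p, R ⟶ CommAlgCat.of k (Localization.Away (f p)) := fun p =>
    CommAlgCat.ofHom (IsScalarTower.toAlgHom k R (Localization.Away (f p)))
  refine eq_zero_of_forall_rTensor_eq_zero (fun p => (π p).hom.toLinearMap) (fun r hr => ?_) _
    fun p => ?_
  · exact eq_zero_of_forall_localization hf hr
  · have h1 := hN (CommAlgCat.of k (Localization.Away (f p))) (H.map (π p) h) (h' p)
      ((hh' p).trans (congrArg _ (toDisc_map ι (π p) h).symm)) (by
        have := hjet.map (π p).hom.toRingHom
        rw [map_one] at this
        rwa [toDisc_map])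
    change extend A.V (π p) _ = 0
    rw [map_sub, A.natural, extend_one_tmul, h1, sub_self]

/-- Elements with the same jet of sufficiently high order act in the same way on a given element of
`R ⊗ V`. -/
theorem IsDilatable.exists_jet_bound_tensor {ι : H ⟶ FormalDisc.K k n} (hι : IsDilatable ι)
    (hA : IsLocallyFinite A) (R : CommAlgCat.{u} k) (x : R ⊗[k] A.V) : ∃ N : ℕ, ∀ g h : H.obj R,
      FormalDisc.JetCongr N (toDisc ι g) (toDisc ι h) → A.ρ R g x = A.ρ R h x := by
  induction x using TensorProduct.induction_on with
  | zero => exact ⟨0, fun g h _ => by rw [map_zero, map_zero]⟩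
  | add x y hx hy =>
    obtain ⟨M, hM⟩ := hx
    obtain ⟨N, hN⟩ := hy
    refine ⟨max M N, fun g h hgh => ?_⟩
    rw [map_add, map_add, hM g h (hgh.mono (le_max_left _ _)), hN g h (hgh.mono (le_max_right _ _))]
  | tmul r v =>
    obtain ⟨N, hN⟩ := hι.exists_jet_bound A hA v
    refine ⟨N, fun g h hgh => ?_⟩
    have h1 := hN R (g⁻¹ * h) (by
      have e : toDisc ι (g⁻¹ * h) = (toDisc ι g)⁻¹ * toDisc ι h := by
        rw [toDisc_mul]
        exact congrArg (· * _) (map_inv (ι.app R).hom g)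
      rw [e]
      exact hgh.inv_mul)
    have h2 := congrArg (fun z => r • A.ρ R g z) h1
    simp only [← A.ρ_mul_apply, mul_inv_cancel_left, ← map_smul, TensorProduct.smul_tmul',
      smul_eq_mul, mul_one] at h2
    exact h2.symm

end JetBound

end GroupPrestack.Representation

/-! ### Representations of `K` and of `K^ét` -/

namespace FormalDisc

open GroupPrestack.Representation

variable (k : Type u) [Field k] (n : ℕ)

lemma isDilatable_K : IsDilatable (𝟙 (K k n)) where
  injective _ _ _ h := h
  exists_scaling _ u := ⟨scaling n u, rfl⟩
  exists_dilate R h p := ⟨1, p.asIdeal.one_notMem,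
    dilate (discAutMap (algebraMap R (Localization.Away (1 : R))) h), rfl⟩

lemma isDilatable_KEt : IsDilatable (KEtIncl k n) where
  injective _ _ _ h := Subtype.ext h
  exists_scaling _ u := ⟨⟨scaling n u, scaling_mem_etaleAut u⟩, rfl⟩
  exists_dilate R h p := by
    obtain ⟨f, hf, hd⟩ := exists_dilate_mem_etaleAut h.2 p
    exact ⟨f, hf, ⟨_, hd⟩, rfl⟩

/-- The versal automorphism of the formal disc has indeterminate coefficients; it is defined over a
polynomial ring with the determinant of the linear part inverted. -/
lemma exists_versal : ∃ (O : CommAlgCat.{u} k) (u : (K k n).obj O),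
    ∀ (R : CommAlgCat.{u} k) (g : (K k n).obj R), ∃ f : O ⟶ R, (K k n).map f u = g := by
  classical
  let S := MvPolynomial (Fin n × (Fin n →₀ ℕ)) k
  let M : Matrix (Fin n) (Fin n) S := Matrix.of fun i j => MvPolynomial.X (i, Finsupp.single j 1)
  let a : Fin n → MvPowerSeries (Fin n) (Localization.Away M.det) := fun i d =>
    if d = 0 then 0 else algebraMap S _ (MvPolynomial.X (i, d))
  have ha : ∀ i d, MvPowerSeries.coeff d (a i) =
      if d = 0 then 0 else algebraMap S _ (MvPolynomial.X (i, d)) := fun i d => rfl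
  have hlin : linearPart a = (algebraMap S (Localization.Away M.det)).mapMatrix M := by
    ext i j
    rw [linearPart_apply, ha, if_neg (by simp)]
    rfl
  obtain ⟨u, hu⟩ := exists_discAut a (fun i => (ha i 0).trans (if_pos rfl)) (by
    rw [hlin, ← RingHom.map_det]
    exact IsLocalization.Away.algebraMap_isUnit M.det)
  refine ⟨CommAlgCat.of k (Localization.Away M.det), u, fun R g => ?_⟩
  let g' : discAut n R := g
  let φ : S →ₐ[k] R := MvPolynomial.aeval fun p => MvPowerSeries.coeff p.2 (g'.1 (MvPowerSeries.X p.1))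
  have hφX : ∀ p, φ (MvPolynomial.X p) = MvPowerSeries.coeff p.2 (g'.1 (MvPowerSeries.X p.1)) :=
    fun p => MvPolynomial.aeval_X _ p
  have hφ : IsUnit (φ M.det) := by
    have e : φ.toRingHom.mapMatrix M = linearPart fun i => g'.1 (MvPowerSeries.X i) := by
      ext i j
      exact hφX (i, Finsupp.single j 1)
    have h := isUnit_det_linearPart g'
    rw [← e, ← RingHom.map_det] at h
    exact h
  let F : Localization.Away M.det →ₐ[k] R :=
    IsLocalization.liftAlgHom (M := Submonoid.powers M.det) (f := φ) (by
      rintro ⟨_, c, rfl⟩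
      rw [map_pow]
      exact hφ.pow c)
  have hF : ∀ s : S, F (algebraMap S _ s) = φ s := fun s => IsLocalization.lift_eq _ s
  refine ⟨CommAlgCat.ofHom F, ?_⟩
  change discAutMap (F : Localization.Away M.det →+* R) u = g'
  refine discAut_ext fun i => ?_
  rw [discAutMap_X, hu]
  ext1 d
  rw [MvPowerSeries.coeff_map, ha]
  split_ifs with hd
  · subst hd
    rw [map_zero]
    exact (g'.2 i).symm
  · exact (hF _).trans (hφX (i, d))

variable {k n}

theorem isLocallyFinite_of_K (A : GroupPrestack.Representation (K k n)) : IsLocallyFinite A := by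
  obtain ⟨O, u, hu⟩ := exists_versal k n
  exact A.isLocallyFinite_of_versal O u hu

lemma exists_jet_bound_K (A : GroupPrestack.Representation (K k n)) (R : CommAlgCat.{u} k)
    (x : R ⊗[k] A.V) : ∃ N : ℕ, ∀ g h : discAut n R, JetCongr N g h → A.ρ R g x = A.ρ R h x :=
  (isDilatable_K k n).exists_jet_bound_tensor A (isLocallyFinite_of_K A) R x

theorem full_res_KEtIncl : (res (KEtIncl k n)).Full where
  map_surjective {A B} F := by
    refine ⟨⟨F.toLin, fun R g x => ?_⟩, rfl⟩
    obtain ⟨N, hN⟩ := exists_jet_bound_K A R x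
    obtain ⟨N', hN'⟩ := exists_jet_bound_K B R (F.toLin.baseChange R x)
    obtain ⟨σ, hσ, hσg⟩ := exists_etaleAut_jetCongr (R := R) g (max N N')
    have h1 := hN σ g (hσg.mono (le_max_left _ _))
    have h2 := hN' σ g (hσg.mono (le_max_right _ _))
    have h3 := F.equivariant R ⟨σ, hσ⟩ x
    exact (congrArg _ h1.symm).trans (Eq.trans h3 h2)

theorem faithful_res_KEtIncl : (res (KEtIncl k n)).Faithful where
  map_injective {A B} F G h := by
    have h1 : ((res (KEtIncl k n)).map F).toLin = ((res (KEtIncl k n)).map G).toLin := by rw [h]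
    exact Hom.ext h1

end FormalDisc

namespace GroupPrestack.Representation

open FormalDisc

variable {k : Type u} [Field k] {n : ℕ} {A : Representation (KEt k n)}

lemma exists_jetCongr_KEt {R : CommAlgCat.{u} k} (g : discAut n R) (c : ℕ) :
    ∃ h : (KEt k n).obj R, JetCongr c (toDisc (KEtIncl k n) h) g := by
  obtain ⟨σ, hσ, h⟩ := exists_etaleAut_jetCongr g c
  exact ⟨⟨σ, hσ⟩, h⟩

/-- The elements of `K^ét(R)` close to `g ∈ K(R)` all act in the same way on `x`. -/
lemma IsLocallyFinite.exists_limit (hA : IsLocallyFinite A) {R : CommAlgCat.{u} k}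
    (g : discAut n R) (x : R ⊗[k] A.V) : ∃ y, ∃ c : ℕ, ∀ h : (KEt k n).obj R,
      JetCongr c (toDisc (KEtIncl k n) h) g → A.ρ R h x = y := by
  obtain ⟨N, hN⟩ := (isDilatable_KEt k n).exists_jet_bound_tensor A hA R x
  obtain ⟨σ, hσ⟩ := exists_jetCongr_KEt g N
  exact ⟨A.ρ R σ x, N, fun h hh => hN h σ (hh.trans hσ.symm)⟩

/-- The action of `g ∈ K(R)` on `x ∈ R ⊗ V`: the common value at `x` of all elements of `K^ét(R)`
close to `g`. -/
def limitAct (hA : IsLocallyFinite A) {R : CommAlgCat.{u} k} (g : discAut n R) (x : R ⊗[k] A.V) :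
    R ⊗[k] A.V :=
  (hA.exists_limit g x).choose

lemma limitAct_spec (hA : IsLocallyFinite A) {R : CommAlgCat.{u} k} (g : discAut n R)
    (x : R ⊗[k] A.V) : ∃ c : ℕ, ∀ h : (KEt k n).obj R,
      JetCongr c (toDisc (KEtIncl k n) h) g → A.ρ R h x = limitAct hA g x :=
  (hA.exists_limit g x).choose_spec

lemma limitAct_add (hA : IsLocallyFinite A) {R : CommAlgCat.{u} k} (g : discAut n R)
    (x y : R ⊗[k] A.V) : limitAct hA g (x + y) = limitAct hA g x + limitAct hA g y := by
  obtain ⟨a, ha⟩ := limitAct_spec hA g x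
  obtain ⟨b, hb⟩ := limitAct_spec hA g y
  obtain ⟨c, hc⟩ := limitAct_spec hA g (x + y)
  obtain ⟨σ, h⟩ := exists_jetCongr_KEt g (a + b + c)
  rw [← ha σ (h.mono (by omega)), ← hb σ (h.mono (by omega)), ← hc σ (h.mono (by omega)), map_add]

lemma limitAct_smul (hA : IsLocallyFinite A) {R : CommAlgCat.{u} k} (g : discAut n R) (r : R)
    (x : R ⊗[k] A.V) : limitAct hA g (r • x) = r • limitAct hA g x := by
  obtain ⟨a, ha⟩ := limitAct_spec hA g x
  obtain ⟨b, hb⟩ := limitAct_spec hA g (r • x)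
  obtain ⟨σ, h⟩ := exists_jetCongr_KEt g (a + b)
  rw [← ha σ (h.mono (by omega)), ← hb σ (h.mono (by omega)), map_smul]

lemma limitAct_toDisc (hA : IsLocallyFinite A) {R : CommAlgCat.{u} k} (h : (KEt k n).obj R)
    (x : R ⊗[k] A.V) : limitAct hA (toDisc (KEtIncl k n) h) x = A.ρ R h x := by
  obtain ⟨c, hc⟩ := limitAct_spec hA (toDisc (KEtIncl k n) h) x
  exact (hc h fun f => by rw [sub_self]; exact zero_mem _).symm

lemma limitAct_one (hA : IsLocallyFinite A) {R : CommAlgCat.{u} k} (x : R ⊗[k] A.V) :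
    limitAct hA 1 x = x :=
  (limitAct_toDisc hA 1 x).trans (A.ρ_one_apply R x)

lemma limitAct_mul (hA : IsLocallyFinite A) {R : CommAlgCat.{u} k} (g g' : discAut n R)
    (x : R ⊗[k] A.V) : limitAct hA (g * g') x = limitAct hA g (limitAct hA g' x) := by
  obtain ⟨a, ha⟩ := limitAct_spec hA g' x
  obtain ⟨b, hb⟩ := limitAct_spec hA g (limitAct hA g' x)
  obtain ⟨c, hc⟩ := limitAct_spec hA (g * g') x
  obtain ⟨σ, h⟩ := exists_jetCongr_KEt g (a + b + c)
  obtain ⟨τ, h'⟩ := exists_jetCongr_KEt g' (a + b + c)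
  have h1 := hc (σ * τ) ((h.mul h').mono (by omega))
  rw [← h1, A.ρ_mul_apply, ha τ (h'.mono (by omega)), hb σ (h.mono (by omega))]

lemma extend_limitAct (hA : IsLocallyFinite A) {R R' : CommAlgCat.{u} k} (f : R ⟶ R')
    (g : discAut n R) (x : R ⊗[k] A.V) : extend A.V f (limitAct hA g x) =
      limitAct hA (discAutMap f.hom.toRingHom g) (extend A.V f x) := by
  obtain ⟨a, ha⟩ := limitAct_spec hA g x
  obtain ⟨b, hb⟩ := limitAct_spec hA (discAutMap f.hom.toRingHom g) (extend A.V f x)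
  obtain ⟨σ, h⟩ := exists_jetCongr_KEt g (a + b)
  rw [← ha σ (h.mono (by omega)), A.natural f]
  exact hb ((KEt k n).map f σ) ((h.mono (by omega)).map _)

/-- The action of `K(R)` on `R ⊗ V` as a homomorphism into the endomorphism monoid. -/
def limitEnd (hA : IsLocallyFinite A) (R : CommAlgCat.{u} k) :
    discAut n R →* Module.End R (R ⊗[k] A.V) where
  toFun g :=
    { toFun := limitAct hA g
      map_add' := limitAct_add hA g
      map_smul' := limitAct_smul hA g }
  map_one' := LinearMap.ext fun x => limitAct_one hA x
  map_mul' g g' := LinearMap.ext fun x => limitAct_mul hA g g' x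

/-- The extension of a locally finite representation of `K^ét` to a representation of `K` on the same
vector space. -/
def extendToK (hA : IsLocallyFinite A) : Representation (K k n) where
  V := A.V
  ρ R := (LinearMap.GeneralLinearGroup.generalLinearEquiv R (R ⊗[k] A.V)).toMonoidHom.comp
    (limitEnd hA R).toHomUnits
  natural f g x := extend_limitAct hA f g x

/-- The extension restricts to the representation one started with. -/
def resExtendToKIso (hA : IsLocallyFinite A) : (res (KEtIncl k n)).obj (extendToK hA) ≅ A where
  hom := ⟨(LinearMap.id : A.V →ₗ[k] A.V), fun R g x => by
    have h : ∀ y, (LinearMap.id : A.V →ₗ[k] A.V).baseChange R y = y := fun y => by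
      rw [LinearMap.baseChange_id, LinearMap.id_apply]
    exact (h _).trans ((limitAct_toDisc hA g x).trans (congrArg _ (h x).symm))⟩
  inv := ⟨(LinearMap.id : A.V →ₗ[k] A.V), fun R g x => by
    have h : ∀ y, (LinearMap.id : A.V →ₗ[k] A.V).baseChange R y = y := fun y => by
      rw [LinearMap.baseChange_id, LinearMap.id_apply]
    exact (h _).trans ((limitAct_toDisc hA g x).symm.trans
      (congrArg (limitAct hA (toDisc (KEtIncl k n) g)) (h x).symm))⟩
  hom_inv_id := rfl
  inv_hom_id := rfl

/-- Local finiteness is invariant under isomorphism of representations. -/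
lemma IsLocallyFinite.of_iso {H : GroupPrestack k} {A B : Representation H} (e : A ≅ B)
    (hA : IsLocallyFinite A) : IsLocallyFinite B := fun v => by
  have hinv : ∀ w, e.hom.toLin (e.inv.toLin w) = w := fun w =>
    LinearMap.congr_fun (congrArg Hom.toLin e.inv_hom_id) w
  obtain ⟨W, hW, _, hv⟩ := hA (e.inv.toLin v)
  refine ⟨W.map e.hom.toLin, B.isSubrep_of_forall_one_tmul fun R g w hw => ?_, inferInstance,
    ⟨_, hv, hinv v⟩⟩
  obtain ⟨w, hw, rfl⟩ := hw
  have h1 := e.hom.equivariant R g (1 ⊗ₜ w)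
  rw [LinearMap.baseChange_tmul] at h1
  rw [← h1]
  have h2 := hW R g _ (Submodule.tmul_mem_baseChange_of_mem 1 hw)
  generalize A.ρ R g (1 ⊗ₜ w) = y at h2 ⊢
  rw [Submodule.baseChange_eq_span] at h2
  induction h2 using Submodule.span_induction with
  | mem x hx =>
    obtain ⟨w', hw', rfl⟩ := hx
    exact Submodule.tmul_mem_baseChange_of_mem 1 (Submodule.mem_map_of_mem hw')
  | zero => rw [map_zero]; exact zero_mem _
  | add x y _ _ hx hy => rw [map_add]; exact add_mem hx hy
  | smul r x _ hx => rw [map_smul]; exact Submodule.smul_mem _ _ hx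

/-- Restriction preserves local finiteness. -/
lemma IsLocallyFinite.res {H H' : GroupPrestack k} (ι : H' ⟶ H) {A : Representation H}
    (hA : IsLocallyFinite A) : IsLocallyFinite ((Representation.res ι).obj A) := fun v => by
  obtain ⟨W, hW, hW', hv⟩ := hA v
  exact ⟨W, fun R g x hx => hW R (ι.app R g) x hx, hW', hv⟩

theorem essImage_res_KEtIncl :
    (Representation.res (KEtIncl k n)).essImage = IsLocallyFinite (H := KEt k n) := by
  ext A
  constructor
  · rintro ⟨B, ⟨e⟩⟩
    exact ((isLocallyFinite_of_K B).res (KEtIncl k n)).of_iso e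
  · exact fun hA => ⟨extendToK hA, ⟨resExtendToKIso hA⟩⟩

end GroupPrestack.Representation

end

theorem mainTheorem7 (k : Type u) [Field k] [IsAlgClosed k] [CharZero k] (n : ℕ) :
    (GroupPrestack.Representation.res (FormalDisc.KEtIncl k n)).Full ∧
    (GroupPrestack.Representation.res (FormalDisc.KEtIncl k n)).Faithful ∧
    (GroupPrestack.Representation.res (FormalDisc.KEtIncl k n)).essImage =
      (GroupPrestack.Representation.IsLocallyFinite (H := FormalDisc.KEt k n)) :=
  ⟨FormalDisc.full_res_KEtIncl, FormalDisc.faithful_res_KEtIncl,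
    GroupPrestack.Representation.essImage_res_KEtIncl⟩
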